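/- Let $p$ be a prime, $q=p^a$, let ${\bf a}_1,\dots,{\bf a}_N\in\mathbb Z^n$ and ${\bf e}=(e_1,\dots,e_n)\in\mathbb Z^n$, and for $\lambda=(\lambda_1,\dots,\lambda_N)\in\mathbb F_q^N$ put $f_\lambda=\sum_{j=1}^N\lambda_jx^{{\bf a}_j}$. Let $\omega$ be the Teichmüller character of $\mathbb F_q^\times$ (with $\omega(0)=0$). Fix $\pi$ with $\pi^{p-1}=-p$, let $\zeta_p$ be the $p$-th root of unity with $\zeta_p\equiv 1+\pi\pmod{\pi^2}$, and put $\Psi(x)=\zeta_p^{\operatorname{Tr}_{\mathbb F_q/\mathbb F_p}(x)}$. Define $$S(f_\lambda,{\bf e})=\sum_{x\in(\mathbb F_q^\times)^n}\omega(x_1)^{-e_1}\cdots\omega(x_n)^{-e_n}\Psi(f_\lambda(x))\in\mathbb Q_p(\zeta_p,\zeta_{q-1}).$$ For $\beta\in\mathbb Z^n$ let $U^+(\beta)=\{u\in\mathbb N^N: \sum_j u_j{\bf a}_j=\beta\}$. If $U^+(\beta)\ne\emptyset$, let $w(\beta)=\min\{\sum_j u_j: u\in U^+(\beta)\}$ and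 let $U^+_{\min}(\beta)$ be the set of $u\in U^+(\beta)$ with $\sum_j u_j=w(\beta)$. Call $\beta$ good if $U^+(\beta)\neq\emptyset$ and $u_j\le p-1$ for all $u\in U^+_{\min}(\beta)$ and all $j$; for good $\beta$ put $$F_\beta(\lambda)=\sum_{u\in U^+_{\min}(\beta)}\frac{\lambda_1^{u_1}\cdots\lambda_N^{u_N}}{u_1!\cdots u_N!}\in\mathbb F_p[\lambda_1,\dots,\lambda_N].$$ Let $M={\bf e}+(q-1)\mathbb Z^n$ and $U_M=\{u\in\{0,\dots,q-1\}^N:\sum_j u_j{\bf a}_j\in M\}$, and assume $U_M\neq\emptyset$. Write $u_j=\sum_{k=0}^{a-1}u_j^{(k)}p^k$ with $0\le u_j^{(k)}\le p-1$, let $w_p(u)=\sum_{j,k}u_j^{(k)}$ and $w_p(M)=\min\{w_p(u):u\in U_M\}$, and let $U_{M,\min}$ be the set of $u\in U_M$ with $w_p(u)=w_p(M)$. Let $\Gamma_M$ be the set of sequences $(\gamma_0,\dots,\gamma_{a-1})$ of good elements of $\mathbb Z^n$ with $\sum_k p^k\gamma_k\in M$ and $\sum_k w(\gamma_k)=w_p(M)$.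 Let $H\in\mathbb F_p[\lambda_1,\dots,\lambda_N]$ be the reduction modulo $p$ of $$\hat H(\Lambda)=(-1)^n\sum_{u\in U_{M,\min}}\frac{\Lambda_1^{u_1}\cdots\Lambda_N^{u_N}}{\prod_{j,k}u_j^{(k)}!}.$$ Theorem 6.6. (i) $H$ is the Hasse invariant of $S(f_\lambda,{\bf e})$: $(C,H')=(w_p(M),H)$ is the unique pair consisting of an integer $C\geq 0$ and a nonzero polynomial $H'$ over $\mathbb F_p$ for which there is a polynomial $P\in(\mathbb Q\cap\mathbb Z_p)[\Lambda_1,\dots,\Lambda_N]$ of degree at most $q-1$ in each variable, with reduction $H'$ modulo $p$, such that $S(f_\lambda,{\bf e})\equiv P(\omega(\lambda_1),\dots,\omega(\lambda_N))\,\pi^{C}\pmod{\pi^{C+1}}$ for all $\lambda\in\mathbb F_q^N$. (ii) $$H(\lambda)=(-1)^n\sum_{(\gamma_0,\dots,\gamma_{a-1})\in\Gamma_M}F_{\gamma_0}(\lambda)F_{\gamma_1}(\lambda^p)\cdots F_{\gamma_{a-1}}(\lambda^{p^{a-1}}),$$ where $\lambda^{p^k}=(\lambda_1^{p^k},\dots,\lambda_N^{p^k})$.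 (iii) Let $\operatorname{ord}_p$ be the $p$-adic valuation with $\operatorname{ord}_p p=1$ and $\operatorname{ord}_p 0=\infty$. For $\lambda\in\mathbb F_q^N$, if $H(\lambda)\neq0$ then $\operatorname{ord}_pS(f_\lambda,{\bf e})=w_p(M)/(p-1)$, and if $H(\lambda)=0$ then $\operatorname{ord}_pS(f_\lambda,{\bf e})>w_p(M)/(p-1)$. -/

import Mathlib

noncomputable section

namespace ToricSum

/-! ### Combinatorics of the exponent vectors `A 0, …, A (N-1) ∈ ℤⁿ` -/

/-- `U⁺(β)`: the `u ∈ ℕᴺ` with `∑ u_j a_j = β`. -/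
def Uplus {n N : ℕ} (A : Fin N → Fin n → ℤ) (β : Fin n → ℤ) : Set (Fin N → ℕ) :=
  {u | ∑ j, u j • A j = β}

/-- The weight `w(β) = min {∑ u_j | u ∈ U⁺(β)}`, for `β ∈ ℕA`
(the value for `β ∉ ℕA` is never used). -/
def weight {n N : ℕ} (A : Fin N → Fin n → ℤ) (β : Fin n → ℤ) : ℕ :=
  sInf ((fun u : Fin N → ℕ => ∑ j, u j) '' Uplus A β)

/-- `U⁺_min(β)`: the elements of `U⁺(β)` of minimal size. -/
def UplusMin {n N : ℕ} (A : Fin N → Fin n → ℤ) (β : Fin n → ℤ) : Set (Fin N → ℕ) :=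
  {u | u ∈ Uplus A β ∧ ∑ j, u j = weight A β}

theorem uplusMin_finite {n N : ℕ} (A : Fin N → Fin n → ℤ) (β : Fin n → ℤ) :
    (UplusMin A β).Finite := by
  refine (Set.finite_Iic (fun _ : Fin N => weight A β)).subset fun u hu j => ?_
  rw [← hu.2]
  exact Finset.single_le_sum (f := u) (fun _ _ => Nat.zero_le _) (Finset.mem_univ j)

/-- `β` is good: `β ∈ ℕA` and `U⁺_min(β) ⊆ U⁺_{p-1}(β)`. -/
def IsGood {n N : ℕ} (p : ℕ) (A : Fin N → Fin n → ℤ) (β : Fin n → ℤ) : Prop :=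
  (Uplus A β).Nonempty ∧ ∀ u ∈ UplusMin A β, ∀ j, u j ≤ p - 1

theorem uplusMin_nonempty {n N : ℕ} {A : Fin N → Fin n → ℤ} {β : Fin n → ℤ}
    (h : (Uplus A β).Nonempty) : (UplusMin A β).Nonempty := by
  obtain ⟨u, hu, huw⟩ := Nat.sInf_mem (h.image (fun u : Fin N → ℕ => ∑ j, u j))
  exact ⟨u, hu, huw⟩

theorem isGood_finite {n N : ℕ} (p : ℕ) (A : Fin N → Fin n → ℤ) :
    {β | IsGood p A β}.Finite := by
  refine ((Set.finite_Iic (fun _ : Fin N => p - 1)).image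
    (fun u : Fin N → ℕ => ∑ j, u j • A j)).subset fun β hβ => ?_
  obtain ⟨u, hu⟩ := uplusMin_nonempty hβ.1
  exact ⟨u, fun j => hβ.2 u hu j, hu.1⟩

/-- The polynomial `F_β = ∑_{u ∈ U⁺_min(β)} λ^u / (u_1! ⋯ u_N!)` over `𝔽_p`.
It is used for good `β` only; then all `u_j!` are invertible modulo `p`. -/
def F {n N : ℕ} (p : ℕ) [Fact p.Prime] (A : Fin N → Fin n → ℤ) (β : Fin n → ℤ) :
    MvPolynomial (Fin N) (ZMod p) :=
  ∑ u ∈ (uplusMin_finite A β).toFinset,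
    MvPolynomial.monomial (Finsupp.equivFunOnFinite.symm u)
      (∏ j, ((u j).factorial : ZMod p))⁻¹

/-- The `k`-th base-`p` digit of `r`. -/
def digit (p k r : ℕ) : ℕ := r / p ^ k % p

/-- The `p`-weight `w_p(u)`: the sum of the base-`p` digits in positions `0, …, a-1` of all
the `u_j`. -/
def pWeight {N : ℕ} (p a : ℕ) (u : Fin N → ℕ) : ℕ :=
  ∑ j, ∑ k : Fin a, digit p k (u j)

/-- `U_M`: the `u` with `0 ≤ u_j ≤ q - 1` for all `j` (where `q = p ^ a`) and
`∑ u_j a_j ∈ M`. -/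
def UM {n N : ℕ} (p a : ℕ) (A : Fin N → Fin n → ℤ) (M : Set (Fin n → ℤ)) :
    Set (Fin N → ℕ) :=
  {u | (∀ j, u j ≤ p ^ a - 1) ∧ ∑ j, u j • A j ∈ M}

/-- The `p`-weight `w_p(M) = min {w_p(u) | u ∈ U_M}`, for `U_M ≠ ∅`. -/
def pWeightSet {n N : ℕ} (p a : ℕ) (A : Fin N → Fin n → ℤ) (M : Set (Fin n → ℤ)) : ℕ :=
  sInf (pWeight p a '' UM p a A M)

/-- `U_{M,min}`: the elements of `U_M` of minimal `p`-weight. -/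
def UMMin {n N : ℕ} (p a : ℕ) (A : Fin N → Fin n → ℤ) (M : Set (Fin n → ℤ)) :
    Set (Fin N → ℕ) :=
  {u | u ∈ UM p a A M ∧ pWeight p a u = pWeightSet p a A M}

theorem umMin_finite {n N : ℕ} (p a : ℕ) (A : Fin N → Fin n → ℤ) (M : Set (Fin n → ℤ)) :
    (UMMin p a A M).Finite :=
  (Set.finite_Iic (fun _ : Fin N => p ^ a - 1)).subset fun _ hu => hu.1.1

/-- `Γ_M`: the sequences `(γ_0, …, γ_{a-1})` of good elements of `ℤⁿ` with
`∑ p^k γ_k ∈ M` and `w_p(M) = ∑ w(γ_k)`. -/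
def Gam {n N : ℕ} (p a : ℕ) (A : Fin N → Fin n → ℤ) (M : Set (Fin n → ℤ)) :
    Set (Fin a → Fin n → ℤ) :=
  {γ | (∀ k, IsGood p A (γ k)) ∧ ∑ k : Fin a, p ^ (k : ℕ) • γ k ∈ M ∧
    pWeightSet p a A M = ∑ k, weight A (γ k)}

theorem gam_finite {n N : ℕ} (p a : ℕ) (A : Fin N → Fin n → ℤ) (M : Set (Fin n → ℤ)) :
    (Gam p a A M).Finite :=
  (Set.Finite.pi' fun _ : Fin a => isGood_finite p A).subset fun _ hγ => hγ.1

/-- The coset `e + (q - 1)ℤⁿ`. -/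
def twistCoset {n : ℕ} (q : ℕ) (e : Fin n → ℤ) : Set (Fin n → ℤ) :=
  {m | ∃ t : Fin n → ℤ, m = e + ((q : ℤ) - 1) • t}

/-! ### The `p`-adic side

All values lie in `ℚ_p(ζ_p, ζ_{q-1})`, regarded inside the algebraic closure of `ℚ_p` with
its `p`-adic norm. -/

/-- The ring of integers of the algebraic closure of `ℚ_p`. -/
abbrev integers (p : ℕ) [Fact p.Prime] : ValuationSubring (PadicAlgCl p) :=
  (PadicAlgCl.valued p).v.valuationSubring

/-- The residue field of the algebraic closure of `ℚ_p`. -/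
abbrev residueField (p : ℕ) [Fact p.Prime] : Type :=
  IsLocalRing.ResidueField (integers p)

/-- The valuation `ord_p`, normalized by `ord_p p = 1`, with `ord_p 0 = ∞`. -/
def ordP (p : ℕ) [Fact p.Prime] (x : PadicAlgCl p) : WithTop ℝ :=
  open Classical in if x = 0 then ⊤ else ((-Real.logb p ‖x‖ : ℝ) : WithTop ℝ)

/-- `x ≡ y (mod π ^ k)`. -/
def CongrModPow (p : ℕ) [Fact p.Prime] (π : PadicAlgCl p) (k : ℕ) (x y : PadicAlgCl p) : Prop :=
  ∃ z ∈ integers p, x - y = z * π ^ k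

theorem mem_integers_iff {p : ℕ} [Fact p.Prime] {x : PadicAlgCl p} :
    x ∈ integers p ↔ ‖x‖ ≤ 1 := Iff.rfl

/-- Existence and uniqueness of the Teichmüller representative. -/
theorem existsUnique_teichmuller {p : ℕ} [Fact p.Prime] {K : Type*} [Field K] [Fintype K]
    (ι : K →+* residueField p) (x : K) :
    ∃! y : integers p, y ^ Fintype.card K = y ∧ IsLocalRing.residue (integers p) y = ι x := by
  classical
  set q := Fintype.card K with hq
  have hq1 : 1 < q := Fintype.one_lt_card
  have hιx : ι x ^ q = ι x := by rw [← map_pow, FiniteField.pow_card]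
  have hmem : ∀ y : integers p, IsLocalRing.residue (integers p) y = 0 ↔
      ‖(y : PadicAlgCl p)‖ < 1 := by
    intro y
    rw [IsLocalRing.residue_eq_zero_iff, Valuation.mem_maximalIdeal_iff]
    exact Iff.rfl
  -- existence
  have hex : ∃ y : integers p, y ^ q = y ∧ IsLocalRing.residue (integers p) y = ι x := by
    obtain ⟨b, hb⟩ := IsLocalRing.residue_surjective (ι x)
    let f : Polynomial (PadicAlgCl p) := Polynomial.X ^ q - Polynomial.X
    have hmonic : f.Monic := Polynomial.monic_X_pow_sub (by simpa using hq1)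
    have hprod := (IsAlgClosed.splits f).eq_prod_roots
    have heval : ‖f.eval (b : PadicAlgCl p)‖ < 1 := by
      have h0 : IsLocalRing.residue (integers p) (b ^ q - b) = 0 := by
        rw [map_sub, map_pow, hb, hιx, sub_self]
      have h1 := (hmem _).1 h0
      simpa [f] using h1
    obtain ⟨r, hr, hbr⟩ : ∃ r ∈ f.roots, ‖(b : PadicAlgCl p) - r‖ < 1 := by
      by_contra! hcon
      have key : ∀ s : Multiset (PadicAlgCl p), (∀ r ∈ s, 1 ≤ ‖(b : PadicAlgCl p) - r‖) →
          1 ≤ ‖((s.map fun r => Polynomial.X - Polynomial.C r).prod).eval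
            (b : PadicAlgCl p)‖ := by
        intro s
        induction s using Multiset.induction with
        | empty => simp
        | cons r s ih =>
          intro hs
          rw [Multiset.map_cons, Multiset.prod_cons, Polynomial.eval_mul, norm_mul]
          refine one_le_mul_of_one_le_of_one_le ?_ (ih fun r' h' => hs r' (by simp [h']))
          simpa using hs r (by simp)
      have h2 := key f.roots hcon
      rw [hmonic.leadingCoeff, map_one, one_mul] at hprod
      rw [← hprod] at h2
      exact absurd heval (not_lt.2 h2)
    have hrq : r ^ q = r := by
      have := (Polynomial.mem_roots'.1 hr).2
      simpa [f, sub_eq_zero] using this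
    have hrint : r ∈ integers p := by
      rw [mem_integers_iff]
      by_contra! h
      have h3 : ‖r‖ ^ q = ‖r‖ := by rw [← norm_pow, hrq]
      exact absurd h3 (lt_self_pow₀ h hq1).ne'
    refine ⟨⟨r, hrint⟩, Subtype.ext hrq, ?_⟩
    have h4 : IsLocalRing.residue (integers p) (b - ⟨r, hrint⟩) = 0 := (hmem _).2 hbr
    rw [map_sub, hb, sub_eq_zero] at h4
    exact h4.symm
  obtain ⟨y, hy, hyx⟩ := hex
  refine ⟨y, ⟨hy, hyx⟩, ?_⟩
  rintro z ⟨hz, hzx⟩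
  have hcast : (q : residueField p) = 0 := by
    have h5 : (q : K) = 0 := FiniteField.cast_card_eq_zero K
    have h6 := congrArg ι h5
    simpa using h6
  have hsum : IsLocalRing.residue (integers p)
      (∑ i ∈ Finset.range q, z ^ i * y ^ (q - 1 - i)) = 0 := by
    rw [map_sum]
    have h7 : ∀ i ∈ Finset.range q, IsLocalRing.residue (integers p) (z ^ i * y ^ (q - 1 - i)) =
        ι x ^ (q - 1) := by
      intro i hi
      rw [Finset.mem_range] at hi
      rw [map_mul, map_pow, map_pow, hyx, hzx, ← pow_add]
      congr 1
      omega
    rw [Finset.sum_congr rfl h7, Finset.sum_const, Finset.card_range, nsmul_eq_mul, hcast,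
      zero_mul]
  have hgeom := (Commute.all z y).mul_geom_sum₂ q
  rw [hz, hy] at hgeom
  set m := ∑ i ∈ Finset.range q, z ^ i * y ^ (q - 1 - i) with hm
  have h8 : (z - y) * (m - 1) = 0 := by rw [mul_sub, hgeom, mul_one, sub_self]
  rcases mul_eq_zero.1 h8 with h9 | h9
  · exact sub_eq_zero.1 h9
  · rw [sub_eq_zero.1 h9, map_one] at hsum
    exact absurd hsum one_ne_zero

/-- The Teichmüller character `ω` of the finite field `K`, extended by `ω(0) = 0`: if `K` is
identified with a subfield of the residue field by `ι`, then `ω(x)` is the root of `Y ^ q = Y`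
that reduces to `x`. -/
def teichmuller {p : ℕ} [Fact p.Prime] {K : Type*} [Field K] [Fintype K]
    (ι : K →+* residueField p) (x : K) : PadicAlgCl p :=
  ((existsUnique_teichmuller ι x).choose : integers p)

/-- The additive character `Ψ = ψ ∘ Trace` of `K`, where `ψ` is the additive character of `𝔽_p`
with `ψ(1) = ζ`. -/
def additiveChar {p : ℕ} [Fact p.Prime] (K : Type*) [Field K] [Algebra (ZMod p) K]
    {ζ : PadicAlgCl p} (hζ : ζ ^ p = 1) : AddChar K (PadicAlgCl p) :=
  (AddChar.zmodChar p hζ).compAddMonoidHom (Algebra.trace (ZMod p) K).toAddMonoidHom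

/-- The value at `x ∈ (K^×)ⁿ` of the Laurent polynomial `f_λ = ∑_j λ_j x^{a_j}`. -/
def laurentEval {n N : ℕ} {K : Type*} [Field K] (A : Fin N → Fin n → ℤ) (l : Fin N → K)
    (x : Fin n → Kˣ) : K :=
  ∑ j, l j * ∏ i, (x i : K) ^ A j i

open Classical in
/-- The sum `S(f_λ, e) = ∑_{x ∈ (K^×)ⁿ} ω(x_1)^{-e_1} ⋯ ω(x_n)^{-e_n} Ψ(f_λ(x))`. -/
def expSum {n N : ℕ} {p : ℕ} [Fact p.Prime] {K : Type*} [Field K] [Fintype K]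
    (ι : K →+* residueField p) (Ψ : AddChar K (PadicAlgCl p))
    (A : Fin N → Fin n → ℤ) (e : Fin n → ℤ) (l : Fin N → K) : PadicAlgCl p :=
  ∑ x : Fin n → Kˣ, (∏ i, teichmuller ι (x i : K) ^ (-e i)) * Ψ (laurentEval A l x)

/-! ### The Hasse invariant -/

/-- All coefficients lie in `ℚ ∩ ℤ_p`. -/
def IsPIntegral {N : ℕ} (p : ℕ) (P : MvPolynomial (Fin N) ℚ) : Prop :=
  ∀ m, ¬ p ∣ (P.coeff m).den

/-- Coefficientwise reduction modulo `p` (meaningful for polynomials over `ℚ ∩ ℤ_p`). -/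
def reduceMod {N : ℕ} (p : ℕ) [Fact p.Prime] (P : MvPolynomial (Fin N) ℚ) :
    MvPolynomial (Fin N) (ZMod p) :=
  ∑ m ∈ P.support, MvPolynomial.monomial m ((P.coeff m : ℚ) : ZMod p)

/-- The coefficient of `π ^ w_p(M)` in the expansion of `S(f_λ, e)`, as a polynomial in
`Λ_j = ω(λ_j)`: `(-1)^n ∑_{u ∈ U_{M,min}} Λ^u / ∏_{j,k} u_j^{(k)}!`. -/
def hasseLift {n N : ℕ} (p a : ℕ) (A : Fin N → Fin n → ℤ) (M : Set (Fin n → ℤ)) :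
    MvPolynomial (Fin N) ℚ :=
  (-1) ^ n * ∑ u ∈ (umMin_finite p a A M).toFinset,
    MvPolynomial.monomial (Finsupp.equivFunOnFinite.symm u)
      (∏ j, ∏ k : Fin a, ((digit p k (u j)).factorial : ℚ))⁻¹

/-- The Hasse invariant `H`, the reduction of `hasseLift` modulo `p`. -/
def hasseInvariant {n N : ℕ} (p a : ℕ) [Fact p.Prime] (A : Fin N → Fin n → ℤ)
    (M : Set (Fin n → ℤ)) : MvPolynomial (Fin N) (ZMod p) :=
  reduceMod p (hasseLift p a A M)

/-- `S : K^N → ℚ_p(ζ_p, ζ_{q-1})` has leading exponent `C` and Hasse invariant `H`: there is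
`Ĥ ∈ (ℚ ∩ ℤ_p)[Λ_1, …, Λ_N]` of degree at most `q - 1` in each variable with reduction
`H ≠ 0` modulo `p` such that `S(λ) ≡ Ĥ(ω(λ)) π^C (mod π^{C+1})` for all `λ`. -/
def IsHasseInvariant {N : ℕ} {p : ℕ} [Fact p.Prime] {K : Type*} [Field K] [Fintype K]
    (ι : K →+* residueField p) (π : PadicAlgCl p) (S : (Fin N → K) → PadicAlgCl p)
    (C : ℕ) (H : MvPolynomial (Fin N) (ZMod p)) : Prop :=
  ∃ P : MvPolynomial (Fin N) ℚ, IsPIntegral p P ∧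
    (∀ j, P.degreeOf j ≤ Fintype.card K - 1) ∧ reduceMod p P = H ∧ H ≠ 0 ∧
    ∀ l : Fin N → K, CongrModPow p π (C + 1) (S l)
      (MvPolynomial.aeval (fun j => teichmuller ι (l j)) P * π ^ C)

end ToricSum

end

noncomputable section

namespace ToricSum

/-! ### Congruences in the algebraic closure of `ℚ_p` -/

section Congruence

variable {p : ℕ} [Fact p.Prime]

/-! Everything rests on expanding `Ψ` in powers of the Teichmüller character, `Ψ(y) = ∑_{u<q} c_u
ω(y)^u` on all of `K`. For `0 < u < q-1` the coefficient `c_u` is the Gauss sum of `ω⁻ᵘ` divided by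
`q-1`. Stickelberger's congruence says `c_u ≡ π^{s(u)} / ∏_k u^{(k)}!` modulo `π^{s(u)+1}`, with
`s(u)` the digit sum; direct computation gives the same at `u = 0` and `u = q-1`
(`norm_fourierCoeff_div_sub_le`). Since `Ψ(f_λ(x))` is the product of the values `Ψ(λ_j x^{a_j})`,
substituting the expansion and summing over `x` by orthogonality leaves exactly the `u` with `∑ u_j
a_j ∈ M`, each with a factor `(q-1)^n ≡ (-1)^n` (`expSum_eq_sum_fourierCoeff`). The term of `u` is
divisible by `π^{w_p(u)}`, so modulo `π^{w_p(M)+1}` only `U_{M,min}` survives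
(`norm_expSum_sub_le`).

The lift of `H` is `p`-integral, so its value at `ω(λ)` is a unit exactly when `H(λ) ≠ 0`; this
gives the valuations. For uniqueness, a polynomial of degree below `q` in each variable is
determined by its values on `Kᴺ`: a point where `H` does not vanish pins down the exponent, and then
all values of `H` are forced.

The product formula comes from carrying. Modulo `q-1` the digit places are cyclic, so trading `p`
copies of `a_j` at one place for one copy at the next stays in `M` and lowers the size by `p-1`.
Hence every array of natural numbers representing an element of `M` has size at least `w_p(M)`, with
equality only for genuine digits (`pWeightSet_le_sum`). So the digit rows of a minimal `u` are
minimal representations of good vectors `γ_k`. Conversely, minimal representations of the terms of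
any `γ ∈ Γ_M` assemble to a minimal `u`, and the sum factors (`sum_UMMin_eq_sum_Gam`). -/

theorem norm_add_le_of_le {x y : PadicAlgCl p} {r : ℝ} (hx : ‖x‖ ≤ r) (hy : ‖y‖ ≤ r) :
    ‖x + y‖ ≤ r :=
  (IsUltrametricDist.norm_add_le_max x y).trans (max_le hx hy)

theorem norm_sub_le_of_le {x y : PadicAlgCl p} {r : ℝ} (hx : ‖x‖ ≤ r) (hy : ‖y‖ ≤ r) :
    ‖x - y‖ ≤ r := by
  rw [sub_eq_add_neg]
  exact norm_add_le_of_le hx (by rwa [norm_neg])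

theorem norm_sub_trans {x y z : PadicAlgCl p} {r : ℝ} (hx : ‖x - y‖ ≤ r) (hy : ‖y - z‖ ≤ r) :
    ‖x - z‖ ≤ r := by
  rw [← sub_add_sub_cancel x y z]
  exact norm_add_le_of_le hx hy

theorem norm_finset_sum_le {ι : Type*} {s : Finset ι} {f : ι → PadicAlgCl p} {r : ℝ} (hr : 0 ≤ r)
    (h : ∀ i ∈ s, ‖f i‖ ≤ r) : ‖∑ i ∈ s, f i‖ ≤ r :=
  IsUltrametricDist.norm_sum_le_of_forall_le_of_nonneg hr h

theorem norm_mul_le_of_le {x y : PadicAlgCl p} {r : ℝ} (hx : ‖x‖ ≤ r) (hy : ‖y‖ ≤ 1) :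
    ‖x * y‖ ≤ r := by
  rw [norm_mul]
  exact (mul_le_of_le_one_right (norm_nonneg _) hy).trans hx

theorem norm_mul_sub_mul_le {x y x' y' : PadicAlgCl p} {r : ℝ} (hx : ‖x - x'‖ ≤ r)
    (hy : ‖y - y'‖ ≤ r) (hy1 : ‖y‖ ≤ 1) (hx1 : ‖x'‖ ≤ 1) : ‖x * y - x' * y'‖ ≤ r := by
  have : x * y - x' * y' = (x - x') * y + (y - y') * x' := by ring
  rw [this]
  exact norm_add_le_of_le (norm_mul_le_of_le hx hy1) (norm_mul_le_of_le hy hx1)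

theorem norm_prod_le_one {ι : Type*} {s : Finset ι} {f : ι → PadicAlgCl p}
    (hf : ∀ i ∈ s, ‖f i‖ ≤ 1) : ‖∏ i ∈ s, f i‖ ≤ 1 := by
  rw [norm_prod]
  exact Finset.prod_le_one (fun _ _ => norm_nonneg _) hf

theorem norm_prod_sub_prod_le {ι : Type*} {s : Finset ι} {f g : ι → PadicAlgCl p} {r : ℝ}
    (hr : 0 ≤ r) (hf : ∀ i ∈ s, ‖f i‖ ≤ 1) (hg : ∀ i ∈ s, ‖g i‖ ≤ 1)
    (h : ∀ i ∈ s, ‖f i - g i‖ ≤ r) : ‖∏ i ∈ s, f i - ∏ i ∈ s, g i‖ ≤ r := by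
  classical
  induction s using Finset.induction_on with
  | empty => simpa using hr
  | insert i s hi ih =>
    rw [Finset.prod_insert hi, Finset.prod_insert hi]
    simp only [Finset.mem_insert, forall_eq_or_imp] at hf hg h
    exact norm_mul_sub_mul_le h.1 (ih hf.2 hg.2 h.2) (norm_prod_le_one hf.2) hg.1

theorem norm_pow_sub_pow_le {x y : PadicAlgCl p} {r : ℝ} (hr : 0 ≤ r) (hx : ‖x‖ ≤ 1)
    (hy : ‖y‖ ≤ 1) (h : ‖x - y‖ ≤ r) (m : ℕ) : ‖x ^ m - y ^ m‖ ≤ r := by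
  have := norm_prod_sub_prod_le (s := Finset.range m) (f := fun _ => x) (g := fun _ => y) hr
    (fun _ _ => hx) (fun _ _ => hy) (fun _ _ => h)
  simpa using this

theorem norm_natCast_le_one (m : ℕ) : ‖(m : PadicAlgCl p)‖ ≤ 1 :=
  IsUltrametricDist.norm_natCast_le_one _ m

theorem norm_natCast (m : ℕ) : ‖(m : PadicAlgCl p)‖ = ‖(m : ℚ_[p])‖ := by
  rw [← map_natCast (algebraMap ℚ_[p] (PadicAlgCl p)), PadicAlgCl.norm_extends]

theorem norm_prime : ‖(p : PadicAlgCl p)‖ = (p : ℝ)⁻¹ := by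
  rw [norm_natCast, Padic.norm_p]

theorem norm_natCast_eq_one {m : ℕ} (h : ¬ p ∣ m) : ‖(m : PadicAlgCl p)‖ = 1 := by
  rw [norm_natCast]
  refine le_antisymm (by simpa using Padic.norm_int_le_one (p := p) m) (not_lt.1 fun h' => h ?_)
  have := (Padic.norm_intCast_lt_one_iff (p := p) (k := (m : ℤ))).1 (by simpa using h')
  exact_mod_cast this

theorem norm_natCast_le_of_dvd {m : ℕ} (h : p ∣ m) :
    ‖(m : PadicAlgCl p)‖ ≤ ‖(p : PadicAlgCl p)‖ := by
  obtain ⟨t, rfl⟩ := h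
  push_cast
  exact norm_mul_le_of_le le_rfl (norm_natCast_le_one t)

theorem norm_natCast_factorial {m : ℕ} (h : m < p) : ‖(m.factorial : PadicAlgCl p)‖ = 1 :=
  norm_natCast_eq_one fun h' => absurd ((Fact.out : p.Prime).dvd_factorial.1 h') (not_le.2 h)

theorem prime_norm_lt_one : ‖(p : PadicAlgCl p)‖ < 1 := by
  rw [norm_prime]
  exact inv_lt_one_of_one_lt₀ (by exact_mod_cast (Fact.out : p.Prime).one_lt)

theorem residue_eq_zero_iff {y : integers p} :
    IsLocalRing.residue (integers p) y = 0 ↔ ‖(y : PadicAlgCl p)‖ < 1 := by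
  rw [IsLocalRing.residue_eq_zero_iff, Valuation.mem_maximalIdeal_iff]
  exact Iff.rfl

/-! ### The element `π` with `π^{p-1} = -p` -/

section Uniformizer

variable {π : PadicAlgCl p} (hπ : π ^ (p - 1) = -(p : PadicAlgCl p))

include hπ

theorem norm_uniformizer_pow : ‖π‖ ^ (p - 1) = (p : ℝ)⁻¹ := by
  rw [← norm_pow, hπ, norm_neg, norm_prime]

theorem uniformizer_ne_zero : π ≠ 0 := by
  rintro rfl
  have h := norm_uniformizer_pow hπ
  have hp := (Fact.out : p.Prime).two_le
  rw [norm_zero, zero_pow (by omega)] at h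
  have : (p : ℝ) ≠ 0 := by exact_mod_cast (Fact.out : p.Prime).ne_zero
  exact inv_ne_zero this h.symm

theorem norm_uniformizer_lt_one : ‖π‖ < 1 := by
  by_contra! h
  have h1 : 1 ≤ ‖π‖ ^ (p - 1) := one_le_pow₀ h
  rw [norm_uniformizer_pow hπ] at h1
  exact absurd h1 (not_le.2 (by simpa [norm_prime] using prime_norm_lt_one (p := p)))

theorem norm_prime_le_uniformizer : ‖(p : PadicAlgCl p)‖ ≤ ‖π‖ := by
  rw [norm_prime, ← norm_uniformizer_pow hπ]
  have hp := (Fact.out : p.Prime).two_le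
  exact pow_le_of_le_one (norm_nonneg _) (norm_uniformizer_lt_one hπ).le (by omega)

/-- The valuation on the algebraic closure is not discrete, so equality of residues does not imply a
congruence modulo `π`. Norm bounds keep track of the exact modulus, and the congruences below are
proved in this form. -/
theorem congrModPow_iff {k : ℕ} {x y : PadicAlgCl p} :
    CongrModPow p π k x y ↔ ‖x - y‖ ≤ ‖π‖ ^ k := by
  have h0 := uniformizer_ne_zero hπ
  constructor
  · rintro ⟨z, hz, h⟩
    rw [h, norm_mul, norm_pow]
    exact mul_le_of_le_one_left (by positivity) (mem_integers_iff.1 hz)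
  · intro h
    refine ⟨(x - y) / π ^ k, mem_integers_iff.2 ?_, (div_mul_cancel₀ _ (pow_ne_zero _ h0)).symm⟩
    rw [norm_div, norm_pow]
    exact div_le_one_of_le₀ h (by positivity)

end Uniformizer

end Congruence

/-! ### The Teichmüller character -/

section Teichmuller

variable {p : ℕ} [Fact p.Prime] {K : Type*} [Field K] [Fintype K] (ι : K →+* residueField p)

/-- The Teichmüller representative as an element of the ring of integers. -/
def teichmullerInt (x : K) : integers p := (existsUnique_teichmuller ι x).choose

theorem coe_teichmullerInt (x : K) : (teichmullerInt ι x : PadicAlgCl p) = teichmuller ι x := rfl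

theorem teichmullerInt_pow_card (x : K) :
    teichmullerInt ι x ^ Fintype.card K = teichmullerInt ι x :=
  (existsUnique_teichmuller ι x).choose_spec.1.1

theorem residue_teichmullerInt (x : K) :
    IsLocalRing.residue (integers p) (teichmullerInt ι x) = ι x :=
  (existsUnique_teichmuller ι x).choose_spec.1.2

theorem teichmullerInt_unique {x : K} {y : integers p} (hy : y ^ Fintype.card K = y)
    (hyx : IsLocalRing.residue (integers p) y = ι x) : y = teichmullerInt ι x :=
  (existsUnique_teichmuller ι x).choose_spec.2 y ⟨hy, hyx⟩

theorem teichmullerInt_mul (x y : K) :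
    teichmullerInt ι (x * y) = teichmullerInt ι x * teichmullerInt ι y := by
  refine (teichmullerInt_unique ι ?_ ?_).symm
  · rw [mul_pow, teichmullerInt_pow_card, teichmullerInt_pow_card]
  · simp only [map_mul, residue_teichmullerInt]

theorem teichmullerInt_one : teichmullerInt ι 1 = 1 :=
  (teichmullerInt_unique ι (one_pow _) (by simp)).symm

theorem teichmullerInt_zero : teichmullerInt ι 0 = 0 :=
  (teichmullerInt_unique ι (zero_pow Fintype.card_ne_zero) (by simp)).symm

/-- The Teichmüller character as a homomorphism of monoids with zero. -/
def teichmullerHom : K →*₀ PadicAlgCl p where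
  toFun := teichmuller ι
  map_zero' := by rw [← coe_teichmullerInt, teichmullerInt_zero]; rfl
  map_one' := by rw [← coe_teichmullerInt, teichmullerInt_one]; rfl
  map_mul' x y := by
    rw [← coe_teichmullerInt, teichmullerInt_mul]; rfl

theorem teichmullerHom_apply (x : K) : teichmullerHom ι x = teichmuller ι x := rfl

theorem norm_teichmuller_le_one (x : K) : ‖teichmullerHom ι x‖ ≤ 1 :=
  mem_integers_iff.1 (teichmullerInt ι x).2

theorem teichmuller_pow_card (x : K) :
    teichmullerHom ι x ^ Fintype.card K = teichmullerHom ι x :=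
  congrArg Subtype.val (teichmullerInt_pow_card ι x)

theorem teichmullerHom_injective : Function.Injective (teichmullerHom ι) := by
  intro x y h
  have h1 : teichmullerInt ι x = teichmullerInt ι y := Subtype.ext h
  apply ι.injective
  rw [← residue_teichmullerInt, h1, residue_teichmullerInt]

/-- The Teichmüller character as a multiplicative character. -/
def teichmullerChar : MulChar K (PadicAlgCl p) where
  toMonoidHom := (teichmullerHom ι).toMonoidHom
  map_nonunit' x hx := by
    have : x = 0 := by simpa using hx
    subst this
    exact map_zero (teichmullerHom ι)

theorem teichmullerChar_apply (x : K) : teichmullerChar ι x = teichmullerHom ι x := rfl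

include ι in
theorem prime_dvd_card : p ∣ Fintype.card K := by
  have h6 := congrArg ι (FiniteField.cast_card_eq_zero K)
  rw [map_natCast, map_zero] at h6
  have h7 : IsLocalRing.residue (integers p) ((Fintype.card K : ℕ) : integers p) = 0 := by
    rw [map_natCast, h6]
  rw [residue_eq_zero_iff] at h7
  by_contra h
  have := norm_natCast_eq_one (p := p) h
  simp at h7
  exact absurd this h7.ne

/-- A quantitative Hensel estimate at a simple root of `Y^q = Y`: `z^q - z` is `z - ω(x)` times `m -
1`, where `m` is a sum of `q` terms with the same residue. So `m` has residue zero and `m - 1` is a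
unit. -/
theorem norm_sub_teichmuller_le {a : ℕ} (hK : Fintype.card K = p ^ a) {x : K} {z : integers p}
    (hz : IsLocalRing.residue (integers p) z = ι x) {r : ℝ}
    (h : ‖(z : PadicAlgCl p) ^ Fintype.card K - z‖ ≤ r) :
    ‖(z : PadicAlgCl p) - teichmullerHom ι x‖ ≤ r := by
  set q := Fintype.card K
  set y := teichmullerInt ι x with hy
  have hcast : (q : residueField p) = 0 := by
    have h6 := congrArg ι (FiniteField.cast_card_eq_zero K)
    rwa [map_natCast, map_zero] at h6
  have hsum : IsLocalRing.residue (integers p)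
      (∑ i ∈ Finset.range q, z ^ i * y ^ (q - 1 - i)) = 0 := by
    rw [map_sum]
    have h7 : ∀ i ∈ Finset.range q, IsLocalRing.residue (integers p) (z ^ i * y ^ (q - 1 - i)) =
        ι x ^ (q - 1) := by
      intro i hi
      rw [Finset.mem_range] at hi
      rw [map_mul, map_pow, map_pow, hz, hy, residue_teichmullerInt, ← pow_add]
      congr 1
      omega
    rw [Finset.sum_congr rfl h7, Finset.sum_const, Finset.card_range, nsmul_eq_mul, hcast,
      zero_mul]
  have hgeom := (Commute.all z y).mul_geom_sum₂ q
  set m := ∑ i ∈ Finset.range q, z ^ i * y ^ (q - 1 - i) with hm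
  rw [show y ^ q = y from teichmullerInt_pow_card ι x] at hgeom
  have h8 : (z - y) * (1 - m) = -(z ^ q - z) := by rw [mul_sub, hgeom]; ring
  have h9 : ‖((1 - m : integers p) : PadicAlgCl p)‖ = 1 := by
    refine le_antisymm (mem_integers_iff.1 (1 - m).2) (not_lt.1 fun hlt => ?_)
    have := residue_eq_zero_iff.2 hlt
    rw [map_sub, hsum, map_one, sub_zero] at this
    exact one_ne_zero this
  have h10 := congrArg (fun t : integers p => ‖(t : PadicAlgCl p)‖) h8
  simp only [MulMemClass.coe_mul, norm_mul, h9, mul_one] at h10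
  have h11 : ‖((-(z ^ q - z) : integers p) : PadicAlgCl p)‖ = ‖(z : PadicAlgCl p) ^ q - z‖ := by
    push_cast
    rw [norm_neg]
  rw [h11] at h10
  calc ‖(z : PadicAlgCl p) - teichmullerHom ι x‖ = ‖((z - y : integers p) : PadicAlgCl p)‖ := by
        push_cast; rfl
    _ ≤ r := by rw [h10]; exact h

theorem norm_add_pow_prime_pow_sub_le {x y : PadicAlgCl p} (hx : ‖x‖ ≤ 1) (hy : ‖y‖ ≤ 1) (a : ℕ) :
    ‖(x + y) ^ p ^ a - (x ^ p ^ a + y ^ p ^ a)‖ ≤ ‖(p : PadicAlgCl p)‖ := by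
  obtain ⟨r, hr⟩ := exists_add_pow_prime_pow_eq (R := integers p) (Fact.out : p.Prime)
    ⟨x, mem_integers_iff.2 hx⟩ ⟨y, mem_integers_iff.2 hy⟩ a
  have hr' := congrArg Subtype.val hr
  push_cast at hr'
  rw [hr', add_sub_cancel_left, mul_assoc, mul_assoc]
  refine norm_mul_le_of_le le_rfl ?_
  rw [norm_mul, norm_mul]
  exact mul_le_one₀ hx (by positivity) (mul_le_one₀ hy (norm_nonneg _) (mem_integers_iff.1 r.2))

/-- The `q`-th power map is additive modulo `p`, so `ω(x) + ω(y)` satisfies `Y^q = Y` up to a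
multiple of `p` and lies that close to the Teichmüller representative of its residue. Identities in
`K` thereby become congruences modulo `p`. -/
theorem norm_teichmuller_add_sub_le {a : ℕ} (hK : Fintype.card K = p ^ a) (x y : K) :
    ‖teichmullerHom ι x + teichmullerHom ι y - teichmullerHom ι (x + y)‖ ≤
      ‖(p : PadicAlgCl p)‖ := by
  refine norm_sub_teichmuller_le ι hK (z := teichmullerInt ι x + teichmullerInt ι y) ?_ ?_
  · simp only [map_add, residue_teichmullerInt]
  · have h := norm_add_pow_prime_pow_sub_le (norm_teichmuller_le_one ι x)
      (norm_teichmuller_le_one ι y) a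
    rw [← hK, teichmuller_pow_card, teichmuller_pow_card] at h
    exact h

theorem norm_sum_teichmuller_sub_le {a : ℕ} (hK : Fintype.card K = p ^ a) {σ : Type*}
    (s : Finset σ) (f : σ → K) :
    ‖∑ i ∈ s, teichmullerHom ι (f i) - teichmullerHom ι (∑ i ∈ s, f i)‖ ≤
      ‖(p : PadicAlgCl p)‖ := by
  classical
  induction s using Finset.induction_on with
  | empty => simp
  | insert i s hi ih =>
    rw [Finset.sum_insert hi, Finset.sum_insert hi]
    refine norm_sub_trans ?_ (norm_teichmuller_add_sub_le ι hK _ _)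
    rwa [add_sub_add_left_eq_sub]

theorem norm_natCast_sub_teichmuller_le {a : ℕ} (hK : Fintype.card K = p ^ a) (m : ℕ) :
    ‖(m : PadicAlgCl p) - teichmullerHom ι (m : K)‖ ≤ ‖(p : PadicAlgCl p)‖ := by
  simpa using norm_sum_teichmuller_sub_le ι hK (Finset.range m) (fun _ => (1 : K))

end Teichmuller

/-! ### Base-`p` digits -/

section Digits

/-- The sum of the base-`p` digits of `r` in positions `0, …, a - 1`. -/
def digitSum (p a r : ℕ) : ℕ := ∑ k : Fin a, digit p k r

/-- The product of the factorials of the base-`p` digits of `r` in positions `0, …, a - 1`. -/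
def digitFactorial (p a r : ℕ) : ℕ := ∏ k : Fin a, (digit p k r).factorial

theorem pWeight_eq_sum_digitSum {N : ℕ} (p a : ℕ) (u : Fin N → ℕ) :
    pWeight p a u = ∑ j, digitSum p a (u j) := rfl

theorem digit_zero_right (p k : ℕ) : digit p k 0 = 0 := by simp [digit]

theorem digit_lt {p : ℕ} (hp : 0 < p) (k r : ℕ) : digit p k r < p := Nat.mod_lt _ hp

theorem digit_zero_mul (p r : ℕ) : digit p 0 (p * r) = 0 := by simp [digit]

theorem digit_succ_mul {p : ℕ} (hp : 0 < p) (k r : ℕ) :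
    digit p (k + 1) (p * r) = digit p k r := by
  rw [digit, digit, pow_succ', Nat.mul_div_mul_left _ _ hp]

theorem digit_eq_zero_of_lt {p k r : ℕ} (h : r < p ^ k) : digit p k r = 0 := by
  rw [digit, Nat.div_eq_of_lt h, Nat.zero_mod]

theorem digit_zero_succ {p r : ℕ} (hp : 0 < p) (h : ¬ p ∣ r + 1) :
    digit p 0 (r + 1) = digit p 0 r + 1 := by
  have h1 : r % p < p := Nat.mod_lt _ hp
  rw [Nat.dvd_iff_mod_eq_zero, Nat.add_mod] at h
  simp only [digit, pow_zero, Nat.div_one]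
  rcases eq_or_ne p 1 with rfl | hp1
  · simp [Nat.mod_one] at h
  have h2 : 1 % p = 1 := Nat.mod_eq_of_lt (by omega)
  rw [h2] at h
  rw [Nat.add_mod, h2]
  apply Nat.mod_eq_of_lt
  by_contra! h3
  have h4 : r % p + 1 = p := by omega
  exact h (by rw [h4, Nat.mod_self])

theorem digit_succ_succ {p r : ℕ} (h : ¬ p ∣ r + 1) (k : ℕ) :
    digit p (k + 1) (r + 1) = digit p (k + 1) r := by
  rw [digit, digit, pow_succ', ← Nat.div_div_eq_div_mul, ← Nat.div_div_eq_div_mul, Nat.succ_div,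
    if_neg h, add_zero]

theorem digit_pow_sub_one {p a k : ℕ} (hp : 0 < p) (hk : k < a) : digit p k (p ^ a - 1) = p - 1 := by
  obtain ⟨b, rfl⟩ := Nat.exists_eq_add_of_lt hk
  -- Division by `p^k` discards the remainder `p^k - 1`, and the quotient visibly has last digit `p
  -- - 1`.
  have h1 : p ^ (k + b + 1) - 1 = (p * (p ^ b - 1) + (p - 1)) * p ^ k + (p ^ k - 1) := by
    have hb : 0 < p ^ b := pow_pos hp b
    have hkk : 0 < p ^ k := pow_pos hp k
    zify [hb, hkk, hp, pow_pos hp (k + b + 1)]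
    ring
  rw [digit, h1, Nat.add_div_of_dvd_right (dvd_mul_left _ _), Nat.mul_div_cancel _ (pow_pos hp k),
    Nat.div_eq_of_lt (Nat.sub_lt (pow_pos hp k) one_pos), add_zero, Nat.mul_add_mod,
    Nat.mod_eq_of_lt (Nat.sub_lt hp one_pos)]

variable {p : ℕ}

theorem digitSum_mul (hp : 0 < p) {a r : ℕ} (h : p * r < p ^ a) :
    digitSum p a (p * r) = digitSum p a r := by
  cases a with
  | zero => rfl
  | succ b =>
    have h1 : r < p ^ b := by
      rw [pow_succ'] at h
      exact lt_of_mul_lt_mul_left h (Nat.zero_le _)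
    rw [digitSum, digitSum, Fin.sum_univ_succ, Fin.sum_univ_castSucc]
    simp [digit_zero_mul, digit_succ_mul hp, digit_eq_zero_of_lt h1]

theorem digitFactorial_mul (hp : 0 < p) {a r : ℕ} (h : p * r < p ^ a) :
    digitFactorial p a (p * r) = digitFactorial p a r := by
  cases a with
  | zero => rfl
  | succ b =>
    have h1 : r < p ^ b := by
      rw [pow_succ'] at h
      exact lt_of_mul_lt_mul_left h (Nat.zero_le _)
    rw [digitFactorial, digitFactorial, Fin.prod_univ_succ, Fin.prod_univ_castSucc]
    simp [digit_zero_mul, digit_succ_mul hp, digit_eq_zero_of_lt h1]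

theorem digitSum_succ (hp : 0 < p) {a r : ℕ} (ha : a ≠ 0) (h : ¬ p ∣ r + 1) :
    digitSum p a (r + 1) = digitSum p a r + 1 := by
  obtain ⟨b, rfl⟩ := Nat.exists_eq_succ_of_ne_zero ha
  rw [digitSum, digitSum, Fin.sum_univ_succ, Fin.sum_univ_succ]
  simp [digit_zero_succ hp h, digit_succ_succ h]
  ring

theorem digitFactorial_succ (hp : 0 < p) {a r : ℕ} (ha : a ≠ 0) (h : ¬ p ∣ r + 1) :
    digitFactorial p a (r + 1) = digit p 0 (r + 1) * digitFactorial p a r := by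
  obtain ⟨b, rfl⟩ := Nat.exists_eq_succ_of_ne_zero ha
  rw [digitFactorial, digitFactorial, Fin.prod_univ_succ, Fin.prod_univ_succ]
  simp [digit_zero_succ hp h, digit_succ_succ h, Nat.factorial_succ, mul_assoc]

theorem digitSum_zero (p a : ℕ) : digitSum p a 0 = 0 := by simp [digitSum, digit_zero_right]

theorem digitFactorial_zero (p a : ℕ) : digitFactorial p a 0 = 1 := by
  simp [digitFactorial, digit_zero_right]

theorem digitSum_pow_sub_one (hp : 0 < p) (a : ℕ) : digitSum p a (p ^ a - 1) = a * (p - 1) := by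
  rw [digitSum, Finset.sum_congr rfl fun k _ => digit_pow_sub_one hp k.2]
  simp

theorem digitFactorial_pow_sub_one (hp : 0 < p) (a : ℕ) :
    digitFactorial p a (p ^ a - 1) = (p - 1).factorial ^ a := by
  rw [digitFactorial, Finset.prod_congr rfl fun k _ => by rw [digit_pow_sub_one hp k.2]]
  simp

theorem norm_digitFactorial [Fact p.Prime] (a r : ℕ) :
    ‖(digitFactorial p a r : PadicAlgCl p)‖ = 1 := by
  rw [digitFactorial, Nat.cast_prod, norm_prod]
  exact Finset.prod_eq_one fun k _ =>
    norm_natCast_factorial (digit_lt (Fact.out : p.Prime).pos _ _)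

end Digits

/-! ### Sums of Teichmüller representatives over the unit group -/

section Orthogonality

open Classical

variable {p : ℕ} [Fact p.Prime] {K : Type*} [Field K] [Fintype K] (ι : K →+* residueField p)

theorem teichmuller_unit_ne_zero (z : Kˣ) : teichmullerHom ι (z : K) ≠ 0 := by simp

theorem teichmuller_unit_pow (z : Kˣ) :
    teichmullerHom ι (z : K) ^ (Fintype.card K - 1) = 1 := by
  rw [← map_pow, FiniteField.pow_card_sub_one_eq_one _ z.ne_zero, map_one]

theorem norm_teichmuller_unit (z : Kˣ) : ‖teichmullerHom ι (z : K)‖ = 1 := by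
  have h := congrArg norm (teichmuller_unit_pow ι z)
  have hq : 1 < Fintype.card K := Fintype.one_lt_card
  rw [norm_pow, norm_one] at h
  exact (pow_eq_one_iff_of_nonneg (norm_nonneg _) (by omega)).1 h

theorem card_units_cast :
    ((Fintype.card Kˣ : ℕ) : PadicAlgCl p) = (Fintype.card K : PadicAlgCl p) - 1 := by
  rw [Fintype.card_units, Nat.cast_sub Fintype.card_pos, Nat.cast_one]

/-- The map `z ↦ ω(z)^m` is a character of a cyclic group of order `q - 1`; as `ω` is injective, it
is trivial exactly when `q - 1` divides `m`. -/
theorem sum_units_teichmuller_zpow (m : ℤ) :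
    ∑ z : Kˣ, teichmullerHom ι (z : K) ^ m =
      if ((Fintype.card K : ℤ) - 1) ∣ m then (Fintype.card K : PadicAlgCl p) - 1 else 0 := by
  let f : Kˣ →* PadicAlgCl p :=
    { toFun := fun z => teichmullerHom ι (z : K) ^ m
      map_one' := by simp
      map_mul' := fun x y => by simp [mul_zpow] }
  have hf : f = 1 ↔ ((Fintype.card K : ℤ) - 1) ∣ m := by
    have hc : ((Fintype.card K : ℤ) - 1) = (Fintype.card Kˣ : ℕ) := by
      rw [Fintype.card_units, Nat.cast_sub Fintype.card_pos, Nat.cast_one]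
    rw [hc]
    have key : ∀ z : Kˣ, f z = 1 ↔ z ^ m = 1 := by
      intro z
      have h1 : f z = teichmullerHom ι ((z ^ m : Kˣ) : K) := by
        simp [f, map_zpow₀]
      rw [h1, ← map_one (teichmullerHom ι), (teichmullerHom_injective ι).eq_iff, Units.val_eq_one]
    constructor
    · intro h
      obtain ⟨g, hg⟩ := IsCyclic.exists_generator (α := Kˣ)
      have h2 := (key g).1 (by rw [h]; rfl)
      rw [← orderOf_dvd_iff_zpow_eq_one, orderOf_eq_card_of_forall_mem_zpowers hg,
        Nat.card_eq_fintype_card] at h2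
      exact h2
    · rintro ⟨t, rfl⟩
      ext z
      rw [MonoidHom.one_apply, key, zpow_mul, zpow_natCast, pow_card_eq_one, one_zpow]
  have h := sum_hom_units f
  simp only [hf] at h
  refine h.trans ?_
  split_ifs
  · exact card_units_cast
  · simp

theorem sum_prod_units_teichmuller_zpow {n : ℕ} (m : Fin n → ℤ) :
    ∑ x : Fin n → Kˣ, ∏ i, teichmullerHom ι (x i : K) ^ m i =
      if ∀ i, ((Fintype.card K : ℤ) - 1) ∣ m i then
        ((Fintype.card K : PadicAlgCl p) - 1) ^ n else 0 := by
  have h := Finset.prod_univ_sum (fun _ : Fin n => (Finset.univ : Finset Kˣ))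
    (fun i z => teichmullerHom ι (z : K) ^ m i)
  rw [Fintype.piFinset_univ] at h
  rw [← h, Finset.prod_congr rfl fun i _ => sum_units_teichmuller_zpow ι (m i)]
  split_ifs with hm
  · rw [Finset.prod_congr rfl fun i _ => if_pos (hm i)]
    simp
  · push Not at hm
    obtain ⟨i, hi⟩ := hm
    exact Finset.prod_eq_zero (Finset.mem_univ i) (if_neg hi)

include ι in
theorem norm_card_sub_one : ‖(Fintype.card K : PadicAlgCl p) - 1‖ = 1 := by
  rw [← card_units_cast]
  apply norm_natCast_eq_one
  intro h
  have h1 := prime_dvd_card ι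
  rw [Fintype.card_units] at h
  have h2 := Nat.sub_add_cancel (Fintype.card_pos (α := K))
  rw [← h2, Nat.dvd_add_right h, Nat.dvd_one] at h1
  exact (Fact.out : p.Prime).one_lt.ne' h1

include ι in
theorem norm_card_le : ‖(Fintype.card K : PadicAlgCl p)‖ ≤ ‖(p : PadicAlgCl p)‖ :=
  norm_natCast_le_of_dvd (prime_dvd_card ι)

end Orthogonality

/-! ### Gauss sums attached to powers of the Teichmüller character -/

section GaussSums

open Classical

variable {p : ℕ} [Fact p.Prime] {K : Type*} [Field K] [Fintype K] (ι : K →+* residueField p)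
  (Ψ : AddChar K (PadicAlgCl p))

/-- The Gauss sum of `ω⁻ᵘ`. -/
def gaussTeich (u : ℕ) : PadicAlgCl p := gaussSum ((teichmullerChar ι)⁻¹ ^ u) Ψ

theorem teichmullerChar_inv_pow_unit (u : ℕ) (z : Kˣ) :
    ((teichmullerChar ι)⁻¹ ^ u) (z : K) = (teichmullerHom ι (z : K))⁻¹ ^ u := by
  rw [MulChar.pow_apply_coe, MulChar.inv_apply', teichmullerChar_apply, map_inv₀]

theorem gaussTeich_eq_sum_units (u : ℕ) :
    gaussTeich ι Ψ u = ∑ z : Kˣ, (teichmullerHom ι (z : K))⁻¹ ^ u * Ψ z := by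
  rw [gaussTeich, gaussSum, Fintype.sum_eq_add_sum_subtype_ne _ (0 : K), MulChar.map_zero, zero_mul,
    zero_add]
  refine (Fintype.sum_equiv unitsEquivNeZero _ _ fun z => ?_).symm
  rw [← teichmullerChar_inv_pow_unit]
  rfl

/-- Fourier inversion on `Kˣ`: for `z ≠ y` the ratio `ω(y/z)` is a `(q-1)`-st root of unity other
than `1`, so its geometric sum vanishes. -/
theorem sum_gaussTeich_mul_pow (y : Kˣ) :
    ∑ u ∈ Finset.range (Fintype.card K - 1), gaussTeich ι Ψ u * teichmullerHom ι (y : K) ^ u =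
      ((Fintype.card K : PadicAlgCl p) - 1) * Ψ y := by
  have h1 : ∀ z : Kˣ, ∑ u ∈ Finset.range (Fintype.card K - 1),
      (teichmullerHom ι (z : K))⁻¹ ^ u * Ψ z * teichmullerHom ι (y : K) ^ u =
      if z = y then ((Fintype.card K : PadicAlgCl p) - 1) * Ψ y else 0 := by
    intro z
    set r := teichmullerHom ι ((y / z : Kˣ) : K) with hr
    have h2 : ∀ u, (teichmullerHom ι (z : K))⁻¹ ^ u * Ψ z * teichmullerHom ι (y : K) ^ u =
        r ^ u * Ψ z := by
      intro u
      rw [hr, Units.val_div_eq_div_val, map_div₀, div_eq_mul_inv, mul_pow]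
      ring
    rw [Finset.sum_congr rfl fun u _ => h2 u, ← Finset.sum_mul]
    split_ifs with hzy
    · subst hzy
      simp [hr, Nat.cast_sub (Fintype.card_pos (α := K))]
    · have h3 := mul_geom_sum r (Fintype.card K - 1)
      rw [hr, teichmuller_unit_pow, sub_self, ← hr] at h3
      have h4 : r - 1 ≠ 0 := by
        rw [sub_ne_zero, hr, Ne, ← map_one (teichmullerHom ι),
          (teichmullerHom_injective ι).eq_iff, Units.val_eq_one, div_eq_one]
        exact fun h => hzy h.symm
      rw [(mul_eq_zero.1 h3).resolve_left h4, zero_mul]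
  simp only [gaussTeich_eq_sum_units, Finset.sum_mul]
  rw [Finset.sum_comm, Finset.sum_congr rfl fun z _ => h1 z]
  simp

/-- The coefficients of the expansion of `Ψ` in powers `ω⁰, …, ω^{q-1}`. -/
def fourierCoeff (u : ℕ) : PadicAlgCl p :=
  if u = 0 then 1
  else if u = Fintype.card K - 1 then
    -(Fintype.card K : PadicAlgCl p) / ((Fintype.card K : PadicAlgCl p) - 1)
  else gaussTeich ι Ψ u / ((Fintype.card K : PadicAlgCl p) - 1)

/-- Inversion on `Kˣ` has constant coefficient `-1/(q-1)`, but the expansion must also give `Ψ 0 =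
1`. Since `ω^{q-1}` is `1` on `Kˣ` and `0` at `0`, the constant term can be set to `1` and the
difference `-1/(q-1) - 1 = -q/(q-1)` moved to `u = q-1`. -/
theorem addChar_eq_sum_fourierCoeff (hΨ : Ψ ≠ 1) (y : K) :
    Ψ y = ∑ u ∈ Finset.range (Fintype.card K), fourierCoeff ι Ψ u * teichmullerHom ι y ^ u := by
  have hq : 1 < Fintype.card K := Fintype.one_lt_card
  have hq0 : (Fintype.card K : PadicAlgCl p) - 1 ≠ 0 := by
    rw [← norm_ne_zero_iff, norm_card_sub_one ι]; exact one_ne_zero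
  rcases eq_or_ne y 0 with rfl | hy
  · rw [Finset.sum_eq_single 0]
    · simp [fourierCoeff]
    · intro u _ hu
      simp [hu]
    · intro h
      simp at h
  · obtain ⟨y, rfl⟩ : ∃ z : Kˣ, (z : K) = y := ⟨Units.mk0 y hy, rfl⟩
    have h1 := sum_gaussTeich_mul_pow ι Ψ y
    obtain ⟨r, hr⟩ : ∃ r, Fintype.card K = r + 2 := ⟨Fintype.card K - 2, by omega⟩
    have h2 := teichmuller_unit_pow ι y
    have h0 : gaussTeich ι Ψ 0 = -1 := by
      rw [gaussTeich, pow_zero, gaussSum_one_left hΨ]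
    have h3 : ∀ u ∈ Finset.range r, fourierCoeff ι Ψ (u + 1) *
        teichmullerHom ι (y : K) ^ (u + 1) = gaussTeich ι Ψ (u + 1) *
        teichmullerHom ι (y : K) ^ (u + 1) / ((Fintype.card K : PadicAlgCl p) - 1) := by
      intro u hu
      rw [Finset.mem_range] at hu
      rw [fourierCoeff, if_neg (by omega), if_neg (by omega)]
      ring
    rw [show Fintype.card K - 1 = r + 1 by omega] at h1 h2
    rw [Finset.sum_range_succ', h0] at h1
    have h4 : Finset.range (Fintype.card K) = Finset.range (r + 1 + 1) := by rw [hr]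
    have h5 : fourierCoeff ι Ψ (r + 1) =
        -(Fintype.card K : PadicAlgCl p) / ((Fintype.card K : PadicAlgCl p) - 1) := by
      rw [fourierCoeff, if_neg (by omega), if_pos (by omega)]
    rw [h4, Finset.sum_range_succ, Finset.sum_range_succ', Finset.sum_congr rfl h3,
      ← Finset.sum_div, h2, h5]
    have h6 : fourierCoeff ι Ψ 0 = 1 := by simp [fourierCoeff]
    rw [h6]
    field_simp
    linear_combination -h1

end GaussSums

/-! ### Stickelberger's congruence -/

section Stickelberger

open Classical

/-- This is the Jacobi sum of `ω⁻¹` and `ω⁻ᵘ`, with `m = q-1-u`, read in `K`. Dividing `(1-x)^m - 1`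
by `x` leaves powers of `1-x` with exponents below `q-1`, whose sums over `K` vanish; `∑ x⁻¹`
vanishes because `q > 2`. -/
theorem sum_inv_mul_one_sub_pow {K : Type*} [Field K] [Fintype K] (hq : 2 < Fintype.card K)
    {m : ℕ} (hm : m < Fintype.card K) : ∑ x : K, x⁻¹ * (1 - x) ^ m = m := by
  -- With `0⁻¹ = 0` the left side is zero at `x = 0`, while the geometric sum there equals `m`; the
  -- last term compensates.
  have h1 : ∀ x : K, x⁻¹ * (1 - x) ^ m =
      x⁻¹ + (-∑ i ∈ Finset.range m, (1 - x) ^ i) + if x = 0 then (m : K) else 0 := by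
    intro x
    rcases eq_or_ne x 0 with rfl | hx
    · simp
    · have h := mul_neg_geom_sum (1 - x) m
      rw [sub_sub_cancel] at h
      rw [if_neg hx]
      field_simp
      linear_combination h
  have h2 : ∑ x : K, x⁻¹ = 0 := by
    rw [Fintype.sum_equiv (inv_involutive (G := K)).toPerm (fun x => x⁻¹) (fun x => x) fun x => rfl]
    simpa using FiniteField.sum_pow_lt_card_sub_one K 1 (by omega)
  have h3 : ∑ x : K, ∑ i ∈ Finset.range m, (1 - x) ^ i = 0 := by
    rw [Finset.sum_comm]
    refine Finset.sum_eq_zero fun i hi => ?_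
    rw [Finset.mem_range] at hi
    rw [Fintype.sum_equiv (Equiv.subLeft (1 : K)) (fun x => (1 - x) ^ i) (fun x => x ^ i)
      fun x => rfl]
    exact FiniteField.sum_pow_lt_card_sub_one K i (by omega)
  rw [Finset.sum_congr rfl fun x _ => h1 x, Finset.sum_add_distrib, Finset.sum_add_distrib,
    Finset.sum_neg_distrib, h2, h3]
  simp

variable {p : ℕ} [Fact p.Prime] {K : Type*} [Field K] [Fintype K] (ι : K →+* residueField p)

/-- With `m = q-1-u` one has `ω⁻ᵘ(y) = ω(y^m)`, so modulo `p` the Jacobi sum is the Teichmüller lift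
of a sum in `K` equal to `m`. Finally `m ≡ -(u+1)` because `m + u + 1 = q`. -/
theorem norm_jacobiSum_add_digit_le {a : ℕ} (hK : Fintype.card K = p ^ a) {u : ℕ} (hu0 : u ≠ 0)
    (hu : u + 1 < Fintype.card K - 1) :
    ‖jacobiSum ((teichmullerChar ι)⁻¹ ^ 1) ((teichmullerChar ι)⁻¹ ^ u) +
      (digit p 0 (u + 1) : PadicAlgCl p)‖ ≤ ‖(p : PadicAlgCl p)‖ := by
  set q := Fintype.card K with hq
  set m := q - 1 - u with hm
  have hinv : ∀ y : K, y⁻¹ ^ u = y ^ m := by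
    intro y
    rcases eq_or_ne y 0 with rfl | hy
    · rw [inv_zero, zero_pow hu0, zero_pow (by omega)]
    · have h1 : y ^ m * y ^ u = 1 := by
        rw [← pow_add, show m + u = q - 1 by omega]
        exact FiniteField.pow_card_sub_one_eq_one y hy
      rw [inv_pow]
      exact (eq_inv_of_mul_eq_one_left h1).symm
  have h1 : jacobiSum ((teichmullerChar ι)⁻¹ ^ 1) ((teichmullerChar ι)⁻¹ ^ u) =
      ∑ x : K, teichmullerHom ι (x⁻¹ * (1 - x) ^ m) := by
    refine Finset.sum_congr rfl fun x _ => ?_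
    rw [pow_one, MulChar.pow_apply' _ hu0, MulChar.inv_apply', MulChar.inv_apply',
      teichmullerChar_apply, teichmullerChar_apply, ← map_pow, hinv, ← map_mul]
  have h2 := norm_sum_teichmuller_sub_le ι hK Finset.univ (fun x : K => x⁻¹ * (1 - x) ^ m)
  rw [sum_inv_mul_one_sub_pow (by omega) (by omega), ← h1, norm_sub_rev] at h2
  have h3 := norm_sub_trans (norm_natCast_sub_teichmuller_le ι hK m) h2
  rw [norm_sub_rev] at h3
  have h4 : p ∣ m + digit p 0 (u + 1) := by
    have h5 : p ∣ m + (u + 1) := by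
      rw [show m + (u + 1) = q by omega]
      exact prime_dvd_card ι
    have h6 : u + 1 = digit p 0 (u + 1) + p * ((u + 1) / p) := by
      simp only [digit, pow_zero, Nat.div_one]
      exact (Nat.mod_add_div _ _).symm
    rw [h6, ← add_assoc] at h5
    exact (Nat.dvd_add_left (dvd_mul_right _ _)).1 h5
  have h7 := norm_natCast_le_of_dvd h4
  push_cast at h7
  have h8 := norm_add_le_of_le h3 h7
  convert h8 using 2
  ring

variable {π : PadicAlgCl p} (hπ : π ^ (p - 1) = -(p : PadicAlgCl p))

include hπ in
theorem norm_pow_sub_one_add_mul_le {ζ : PadicAlgCl p} (hζπ : CongrModPow p π 2 ζ (1 + π))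
    (hζ : ‖ζ‖ ≤ 1) (T : ℕ) : ‖ζ ^ T - (1 + T * π)‖ ≤ ‖π‖ ^ 2 := by
  rw [congrModPow_iff hπ] at hζπ
  induction T with
  | zero => simp
  | succ T ih =>
    have h1 : ζ ^ (T + 1) - (1 + ((T + 1 : ℕ) : PadicAlgCl p) * π) =
        (ζ ^ T - (1 + T * π)) * ζ + (ζ - (1 + π)) * (1 + T * π) + π ^ 2 * T := by
      push_cast
      ring
    have hπ1 := (norm_uniformizer_lt_one hπ).le
    rw [h1]
    refine norm_add_le_of_le (norm_add_le_of_le (norm_mul_le_of_le ih hζ)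
      (norm_mul_le_of_le hζπ (norm_add_le_of_le (by simp) ?_))) (norm_mul_le_of_le (by simp) ?_)
    · exact norm_mul_le_of_le (norm_natCast_le_one T) hπ1
    · exact norm_natCast_le_one T

theorem norm_eq_one_of_pow_prime_eq_one {ζ : PadicAlgCl p} (hζ : ζ ^ p = 1) : ‖ζ‖ = 1 := by
  have h := congrArg norm hζ
  rw [norm_pow, norm_one] at h
  exact (pow_eq_one_iff_of_nonneg (norm_nonneg _) (Fact.out : p.Prime).ne_zero).1 h

variable [Algebra (ZMod p) K] {ζ : PadicAlgCl p} (hζ : ζ ^ p = 1)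

omit [Fintype K] in
theorem additiveChar_apply (x : K) :
    additiveChar K hζ x = ζ ^ (Algebra.trace (ZMod p) K x).val := by
  rw [additiveChar, AddChar.compAddMonoidHom_apply, AddChar.zmodChar_apply]
  rfl

theorem finrank_eq_of_card {a : ℕ}
    (hK : Fintype.card K = p ^ a) : Module.finrank (ZMod p) K = a := by
  have h := Module.card_eq_pow_finrank (K := ZMod p) (V := K)
  rw [ZMod.card, hK] at h
  exact (Nat.pow_right_injective (Fact.out : p.Prime).two_le h).symm

include hπ in
-- Modulo `π²`, `ζ^T ≡ 1 + Tπ`. The trace is the sum of the Frobenius conjugates, and additivity of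
-- `ω` modulo `π` is enough because of the factor `π`.
theorem norm_additiveChar_sub_le {a : ℕ} (hK : Fintype.card K = p ^ a)
    (hζπ : CongrModPow p π 2 ζ (1 + π)) (x : K) :
    ‖additiveChar K hζ x - (1 + π * ∑ i ∈ Finset.range a, teichmullerHom ι x ^ p ^ i)‖ ≤
      ‖π‖ ^ 2 := by
  rw [additiveChar_apply]
  set t := Algebra.trace (ZMod p) K x with ht
  have h1 : (t.val : K) = ∑ i ∈ Finset.range a, x ^ p ^ i := by
    have h := FiniteField.algebraMap_trace_eq_sum_pow (ZMod p) K x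
    rw [finrank_eq_of_card hK, Nat.card_eq_fintype_card, ZMod.card, ← ht] at h
    rw [← h, ← map_natCast (algebraMap (ZMod p) K), ZMod.natCast_zmod_val]
  have h2 := norm_natCast_sub_teichmuller_le ι hK t.val
  have h3 := norm_sum_teichmuller_sub_le ι hK (Finset.range a) (fun i => x ^ p ^ i)
  rw [← h1, norm_sub_rev] at h3
  simp only [map_pow] at h3
  have h4 := (norm_sub_trans h2 h3).trans (norm_prime_le_uniformizer hπ)
  refine norm_sub_trans (norm_pow_sub_one_add_mul_le hπ hζπ
    (norm_eq_one_of_pow_prime_eq_one hζ).le t.val) ?_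
  rw [mul_comm, add_sub_add_left_eq_sub, ← mul_sub, norm_mul, pow_two]
  exact mul_le_mul_of_nonneg_left h4 (norm_nonneg _)

include hπ in
theorem additiveChar_ne_one (hζπ : CongrModPow p π 2 ζ (1 + π)) : additiveChar K hζ ≠ 1 := by
  intro h
  obtain ⟨x, hx⟩ := Algebra.trace_surjective (ZMod p) K 1
  have h1 := additiveChar_apply hζ x
  have : Fact (1 < p) := ⟨(Fact.out : p.Prime).one_lt⟩
  rw [h, hx, ZMod.val_one, pow_one, AddChar.one_apply] at h1
  rw [congrModPow_iff hπ, ← h1, sub_add_cancel_left, norm_neg] at hζπ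
  have h2 := norm_pos_iff.2 (uniformizer_ne_zero hπ)
  have h3 := norm_uniformizer_lt_one hπ
  nlinarith

theorem additiveChar_pow_prime (x : K) : additiveChar K hζ (x ^ p) = additiveChar K hζ x := by
  have : CharP K p := charP_of_injective_algebraMap (algebraMap (ZMod p) K).injective p
  rw [additiveChar_apply, additiveChar_apply]
  have h := Algebra.trace_eq_of_algEquiv (FiniteField.frobeniusAlgEquiv (ZMod p) K p) x
  rw [FiniteField.frobeniusAlgEquiv_apply, ZMod.card] at h
  rw [h]

/-- Frobenius permutes `K`, preserves the trace, and turns `ω⁻ᵘ` into `ω⁻ᵖᵘ`. -/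
theorem gaussTeich_prime_mul {u : ℕ} (hu : u ≠ 0) :
    gaussTeich ι (additiveChar K hζ) (p * u) = gaussTeich ι (additiveChar K hζ) u := by
  have : CharP K p := charP_of_injective_algebraMap (algebraMap (ZMod p) K).injective p
  refine Fintype.sum_equiv (frobeniusEquiv K p).toEquiv _ _ fun x => ?_
  have h1 : (frobeniusEquiv K p).toEquiv x = x ^ p := rfl
  rw [h1, additiveChar_pow_prime, MulChar.pow_apply' _ hu, map_pow,
    MulChar.pow_apply' _ (mul_ne_zero (Fact.out : p.Prime).ne_zero hu), pow_mul]

include hπ in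
-- After multiplication by `ω⁻¹` and summation over `Kˣ`, only `i = 0` in the linear approximation
-- of `Ψ` survives, since `q-1` divides neither `-1` nor `p^i - 1` for `0 < i < a`. It contributes
-- `π(q-1) ≡ -π`.
theorem norm_gaussTeich_one_add_le {a : ℕ} (hK : Fintype.card K = p ^ a)
    (hζπ : CongrModPow p π 2 ζ (1 + π)) (hq : 2 < Fintype.card K) :
    ‖gaussTeich ι (additiveChar K hζ) 1 + π‖ ≤ ‖π‖ ^ 2 := by
  have hq' : (Fintype.card K : ℤ) = (p : ℤ) ^ a := by rw [hK]; push_cast; rfl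
  obtain ⟨b, rfl⟩ : ∃ b, a = b + 1 :=
    Nat.exists_eq_succ_of_ne_zero (by rintro rfl; simp [hK] at hq)
  have h1 : ∑ z : Kˣ, (teichmullerHom ι (z : K))⁻¹ *
      (1 + π * ∑ i ∈ Finset.range (b + 1), teichmullerHom ι (z : K) ^ p ^ i) =
      π * ((Fintype.card K : PadicAlgCl p) - 1) := by
    have h2 : ∀ z : Kˣ, (teichmullerHom ι (z : K))⁻¹ *
        (1 + π * ∑ i ∈ Finset.range (b + 1), teichmullerHom ι (z : K) ^ p ^ i) =
        teichmullerHom ι (z : K) ^ (-1 : ℤ) + π * ∑ i ∈ Finset.range (b + 1),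
          teichmullerHom ι (z : K) ^ ((p : ℤ) ^ i - 1) := by
      intro z
      have h0 := teichmuller_unit_ne_zero ι z
      have h3 : ∀ i, teichmullerHom ι (z : K) ^ ((p : ℤ) ^ i - 1) =
          (teichmullerHom ι (z : K))⁻¹ * teichmullerHom ι (z : K) ^ p ^ i := by
        intro i
        rw [zpow_sub₀ h0, zpow_one, div_eq_inv_mul]
        congr 1
        exact_mod_cast zpow_natCast (teichmullerHom ι (z : K)) (p ^ i)
      rw [Finset.sum_congr rfl fun i _ => h3 i, ← Finset.mul_sum, zpow_neg_one]
      ring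
    rw [Finset.sum_congr rfl fun z _ => h2 z, Finset.sum_add_distrib,
      sum_units_teichmuller_zpow, if_neg, zero_add, ← Finset.mul_sum, Finset.sum_comm,
      Finset.sum_congr rfl fun i _ => sum_units_teichmuller_zpow ι _, Finset.sum_range_succ']
    · rw [Finset.sum_eq_zero]
      · simp
      · intro i hi
        rw [Finset.mem_range] at hi
        apply if_neg
        intro hd
        have hp := (Fact.out : p.Prime).one_lt
        have h5 : (p : ℤ) ^ (i + 1) < (p : ℤ) ^ (b + 1) :=
          pow_lt_pow_right₀ (by exact_mod_cast hp) (by omega)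
        have h6 : (1 : ℤ) < (p : ℤ) ^ (i + 1) := one_lt_pow₀ (by exact_mod_cast hp) (by omega)
        have h7 := Int.le_of_dvd (by omega) hd
        rw [hq'] at h7
        omega
    · intro hd
      have h7 := Int.le_of_dvd (by norm_num) ((dvd_neg).1 hd)
      omega
  have h4 : ‖gaussTeich ι (additiveChar K hζ) 1 - π * ((Fintype.card K : PadicAlgCl p) - 1)‖ ≤
      ‖π‖ ^ 2 := by
    rw [← h1, gaussTeich_eq_sum_units, ← Finset.sum_sub_distrib]
    refine norm_finset_sum_le (by positivity) fun z _ => ?_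
    rw [pow_one, ← mul_sub, norm_mul, norm_inv, norm_teichmuller_unit, inv_one, one_mul]
    exact norm_additiveChar_sub_le ι hπ hζ hK hζπ z
  have h5 : ‖π * (Fintype.card K : PadicAlgCl p)‖ ≤ ‖π‖ ^ 2 := by
    rw [norm_mul, pow_two]
    exact mul_le_mul_of_nonneg_left ((norm_card_le ι).trans (norm_prime_le_uniformizer hπ))
      (norm_nonneg _)
  have h6 := norm_add_le_of_le h4 h5
  convert h6 using 2
  ring

omit [Algebra (ZMod p) K] in
theorem teichmullerChar_inv_pow_ne_one {u : ℕ} (hu0 : u ≠ 0) (hu : u < Fintype.card K - 1) :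
    (teichmullerChar ι)⁻¹ ^ u ≠ 1 := by
  intro h
  have h1 := sum_units_teichmuller_zpow ι (-(u : ℤ))
  have h2 : ∀ z : Kˣ, teichmullerHom ι (z : K) ^ (-(u : ℤ)) = 1 := by
    intro z
    have h3 := teichmullerChar_inv_pow_unit ι u z
    rw [h, MulChar.one_apply_coe] at h3
    rw [zpow_neg, zpow_natCast, ← inv_pow, ← h3]
  rw [Finset.sum_congr rfl fun z _ => h2 z, if_neg] at h1
  · simp at h1
  · intro hd
    have h7 := Int.le_of_dvd (by omega) ((dvd_neg).1 hd)
    omega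

include hπ in
/-- Stickelberger's congruence for the Gauss sums of the nontrivial characters `ω⁻ᵘ`. -/
theorem norm_gaussTeich_mul_digitFactorial_add_le {a : ℕ} (hK : Fintype.card K = p ^ a)
    (hζπ : CongrModPow p π 2 ζ (1 + π)) {u : ℕ} (hu0 : u ≠ 0) (hu : u < Fintype.card K - 1) :
    ‖gaussTeich ι (additiveChar K hζ) u * digitFactorial p a u / π ^ digitSum p a u + 1‖ ≤
      ‖π‖ := by
  have hp := (Fact.out : p.Prime).pos
  have hp1 := (Fact.out : p.Prime).one_lt
  have ha : a ≠ 0 := by rintro rfl; simp [hK] at hu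
  have hπ0 := uniformizer_ne_zero hπ
  have hπ1 := norm_uniformizer_lt_one hπ
  have hπp : 0 < ‖π‖ := norm_pos_iff.2 hπ0
  have hbase : ‖gaussTeich ι (additiveChar K hζ) 1 / π + 1‖ ≤ ‖π‖ := by
    have h := norm_gaussTeich_one_add_le ι hπ hζ hK hζπ (by omega)
    rw [← div_self hπ0, ← add_div, norm_div, div_le_iff₀ hπp, ← pow_two]
    exact h
  induction u using Nat.strong_induction_on with
  | _ u ih =>
    -- If `p ∣ u`, Frobenius invariance passes to `u/p`, whose digits are those of `u` shifted.
    -- Otherwise `u = r + 1` arises from `r` without a carry, and a Jacobi sum links the Gauss sums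
    -- at `r + 1`, `1` and `r`.
    by_cases hpu : p ∣ u
    · obtain ⟨r, rfl⟩ := hpu
      have hr0 : r ≠ 0 := by rintro rfl; simp at hu0
      have hlt : r < p * r := lt_mul_of_one_lt_left (Nat.pos_of_ne_zero hr0) hp1
      have hlt' : p * r < p ^ a := by omega
      rw [gaussTeich_prime_mul ι hζ hr0, digitSum_mul hp hlt', digitFactorial_mul hp hlt']
      exact ih r hlt hr0 (by omega)
    · obtain ⟨r, rfl⟩ := Nat.exists_eq_succ_of_ne_zero hu0
      rw [Nat.succ_eq_add_one] at *
      rcases eq_or_ne r 0 with rfl | hr0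
      · rw [digitSum_succ hp ha hpu, digitFactorial_succ hp ha hpu, digitSum_zero,
          digitFactorial_zero, digit_zero_succ hp hpu, digit_zero_right]
        simpa using hbase
      · have hJ := norm_jacobiSum_add_digit_le ι hK hr0 hu
        set J := jacobiSum ((teichmullerChar ι)⁻¹ ^ 1) ((teichmullerChar ι)⁻¹ ^ r) with hJdef
        have hG : gaussTeich ι (additiveChar K hζ) (r + 1) * J =
            gaussTeich ι (additiveChar K hζ) 1 * gaussTeich ι (additiveChar K hζ) r := by
          have h1 : ((teichmullerChar ι)⁻¹ ^ 1) * ((teichmullerChar ι)⁻¹ ^ r) =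
              (teichmullerChar ι)⁻¹ ^ (r + 1) := by rw [← pow_add, add_comm]
          have h2 := jacobiSum_mul_nontrivial
            (by rw [h1]; exact teichmullerChar_inv_pow_ne_one ι hu0 hu) (additiveChar K hζ)
          rw [h1] at h2
          exact h2
        set d := digit p 0 (r + 1) with hd
        have hd1 : ‖(d : PadicAlgCl p)‖ = 1 := by
          apply norm_natCast_eq_one
          intro h
          apply hpu
          simp only [hd, digit, pow_zero, Nat.div_one] at h
          rwa [← Nat.dvd_mod_iff (dvd_refl p)]
        have hJ1 : ‖J‖ = 1 := by
          have h1 : ‖J + d‖ < ‖(d : PadicAlgCl p)‖ := by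
            rw [hd1]; exact hJ.trans_lt prime_norm_lt_one
          have h2 := IsUltrametricDist.norm_eq_of_add_norm_lt_max
            (h1.trans_le (le_max_right ‖J‖ _))
          rw [h2, hd1]
        have hr := ih r (by omega) hr0 (by omega)
        set t1 := gaussTeich ι (additiveChar K hζ) 1 / π with ht1
        set tr := gaussTeich ι (additiveChar K hζ) r * digitFactorial p a r / π ^ digitSum p a r
          with htr
        have ht1' : ‖t1‖ ≤ 1 := by
          have h := norm_sub_le_of_le (hbase.trans hπ1.le) (norm_one (α := PadicAlgCl p)).le
          rwa [add_sub_cancel_right] at h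
        have hprod : ‖t1 * tr - (-1) * (-1)‖ ≤ ‖π‖ := by
          refine norm_mul_sub_mul_le ?_ ?_ ?_ (by simp)
          · rwa [sub_neg_eq_add]
          · rwa [sub_neg_eq_add]
          · have h := norm_sub_le_of_le (hr.trans hπ1.le) (norm_one (α := PadicAlgCl p)).le
            rwa [add_sub_cancel_right] at h
        have hJ0 : J ≠ 0 := by rw [← norm_ne_zero_iff, hJ1]; exact one_ne_zero
        -- Passing from `r` to `r + 1` raises the digit sum by one and multiplies the digit
        -- factorial by `d`. So the normalized Gauss sum at `r + 1`, times `J`, is `t1 * tr * d`;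
        -- here `t1` and `tr` are `≡ -1` and the unit `J` is `≡ -d`.
        have hkey : (gaussTeich ι (additiveChar K hζ) (r + 1) * digitFactorial p a (r + 1) /
            π ^ digitSum p a (r + 1) + 1) * J = (t1 * tr - (-1) * (-1)) * d + (J + d) := by
          rw [digitSum_succ hp ha hpu, digitFactorial_succ hp ha hpu, ht1, htr]
          push_cast
          field_simp
          linear_combination (digit p 0 (r + 1) : PadicAlgCl p) * digitFactorial p a r * π *
            π ^ digitSum p a r * hG
        have hfin : ‖(t1 * tr - (-1) * (-1)) * d + (J + d)‖ ≤ ‖π‖ :=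
          norm_add_le_of_le (norm_mul_le_of_le hprod hd1.le)
            (hJ.trans (norm_prime_le_uniformizer hπ))
        rwa [← hkey, norm_mul, hJ1, mul_one] at hfin

include hπ in
/-- Stickelberger's congruence for the Fourier coefficients of `Ψ`. -/
theorem norm_fourierCoeff_div_sub_le {a : ℕ} (hK : Fintype.card K = p ^ a)
    (hζπ : CongrModPow p π 2 ζ (1 + π)) {u : ℕ} (hu : u < Fintype.card K) :
    ‖fourierCoeff ι (additiveChar K hζ) u / π ^ digitSum p a u -
      (digitFactorial p a u : PadicAlgCl p)⁻¹‖ ≤ ‖π‖ := by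
  have hp := (Fact.out : p.Prime).pos
  have hπ0 := uniformizer_ne_zero hπ
  have hπ1 := norm_uniformizer_lt_one hπ
  have hγ1 := norm_digitFactorial (p := p) a u
  have hγ0 : (digitFactorial p a u : PadicAlgCl p) ≠ 0 := by
    rw [← norm_ne_zero_iff, hγ1]; exact one_ne_zero
  have hq1 := norm_card_sub_one (p := p) ι
  have hqp := (norm_card_le (p := p) ι).trans (norm_prime_le_uniformizer hπ)
  have hq0 : (Fintype.card K : PadicAlgCl p) - 1 ≠ 0 := by
    rw [← norm_ne_zero_iff, hq1]; exact one_ne_zero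
  by_cases h0 : u = 0
  · subst h0
    simp [fourierCoeff, digitSum_zero, digitFactorial_zero]
  by_cases h1 : u = Fintype.card K - 1
  · have hc : fourierCoeff ι (additiveChar K hζ) u =
        -(Fintype.card K : PadicAlgCl p) / ((Fintype.card K : PadicAlgCl p) - 1) := by
      rw [fourierCoeff, if_neg h0, if_pos h1]
    -- All `a` digits of `q-1` equal `p-1`, so the power of `π` is `(-p)^a`, which cancels the `q`
    -- in the coefficient up to sign. Wilson's theorem matches that sign with the digit factorials.
    have hs : π ^ digitSum p a u = (-1) ^ a * (Fintype.card K : PadicAlgCl p) := by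
      rw [h1, hK, digitSum_pow_sub_one hp, mul_comm a, pow_mul, hπ, neg_pow]
      push_cast
      rfl
    have hw : ‖((p - 1).factorial : PadicAlgCl p) - (-1)‖ ≤ ‖π‖ := by
      rw [sub_neg_eq_add]
      have h2 : p ∣ (p - 1).factorial + 1 := by
        rw [← ZMod.natCast_eq_zero_iff]
        push_cast
        rw [ZMod.wilsons_lemma, neg_add_cancel]
      have h3 := norm_natCast_le_of_dvd h2
      push_cast at h3
      exact h3.trans (norm_prime_le_uniformizer hπ)
    have hγ : ‖(digitFactorial p a u : PadicAlgCl p) - (-1) ^ a‖ ≤ ‖π‖ := by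
      rw [h1, hK, digitFactorial_pow_sub_one hp]
      push_cast
      exact norm_pow_sub_pow_le (norm_nonneg _) (norm_natCast_le_one _) (by simp) hw a
    have hcard0 : (Fintype.card K : PadicAlgCl p) ≠ 0 := by
      exact_mod_cast Fintype.card_ne_zero
    have hsgn0 : ((-1 : PadicAlgCl p) ^ a) ≠ 0 := by simp
    have hsgn1 : ‖(-1 : PadicAlgCl p) ^ a‖ = 1 := by simp
    have hkey : (fourierCoeff ι (additiveChar K hζ) u / π ^ digitSum p a u -
        (digitFactorial p a u : PadicAlgCl p)⁻¹) *
        ((-1) ^ a * ((Fintype.card K : PadicAlgCl p) - 1) * digitFactorial p a u) =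
        -((digitFactorial p a u : PadicAlgCl p) - (-1) ^ a) -
          (Fintype.card K : PadicAlgCl p) * (-1) ^ a := by
      rw [hc, hs]
      field_simp
      ring
    have hfin : ‖-((digitFactorial p a u : PadicAlgCl p) - (-1) ^ a) -
          (Fintype.card K : PadicAlgCl p) * (-1) ^ a‖ ≤ ‖π‖ :=
      norm_sub_le_of_le (by rwa [norm_neg]) (norm_mul_le_of_le hqp hsgn1.le)
    rwa [← hkey, norm_mul, norm_mul, norm_mul, hsgn1, hq1, hγ1, one_mul, mul_one, mul_one] at hfin
  · have hc : fourierCoeff ι (additiveChar K hζ) u =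
        gaussTeich ι (additiveChar K hζ) u / ((Fintype.card K : PadicAlgCl p) - 1) := by
      rw [fourierCoeff, if_neg h0, if_neg h1]
    have hG := norm_gaussTeich_mul_digitFactorial_add_le ι hπ hζ hK hζπ h0 (by omega)
    have hkey : (fourierCoeff ι (additiveChar K hζ) u / π ^ digitSum p a u -
        (digitFactorial p a u : PadicAlgCl p)⁻¹) *
        (((Fintype.card K : PadicAlgCl p) - 1) * digitFactorial p a u) =
        (gaussTeich ι (additiveChar K hζ) u * digitFactorial p a u / π ^ digitSum p a u + 1) -
          (Fintype.card K : PadicAlgCl p) := by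
      rw [hc]
      field_simp
      ring
    have hfin := norm_sub_le_of_le hG hqp
    rwa [← hkey, norm_mul, norm_mul, hq1, hγ1, mul_one, mul_one] at hfin

end Stickelberger

/-! ### Digit expansions and carrying -/

section Carrying

/-- The number with base-`p` digits `d k`. -/
def ofDigitVec {a : ℕ} (p : ℕ) (d : Fin a → ℕ) : ℕ := ∑ k : Fin a, p ^ (k : ℕ) * d k

theorem ofDigitVec_eq_finFunctionFinEquiv {a p : ℕ} {d : Fin a → ℕ} (hd : ∀ k, d k < p) :
    ofDigitVec p d = finFunctionFinEquiv (fun k => (⟨d k, hd k⟩ : Fin p)) := by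
  rw [finFunctionFinEquiv_apply, ofDigitVec]
  exact Finset.sum_congr rfl fun _ _ => mul_comm _ _

theorem ofDigitVec_lt {a p : ℕ} {d : Fin a → ℕ} (hd : ∀ k, d k < p) : ofDigitVec p d < p ^ a := by
  rw [ofDigitVec_eq_finFunctionFinEquiv hd]
  exact Fin.is_lt _

theorem digit_ofDigitVec {a p : ℕ} {d : Fin a → ℕ} (hd : ∀ k, d k < p) (k : Fin a) :
    digit p k (ofDigitVec p d) = d k := by
  have h := congrFun (finFunctionFinEquiv.symm_apply_apply (fun k => (⟨d k, hd k⟩ : Fin p))) k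
  have h1 := congrArg Fin.val h
  rw [finFunctionFinEquiv_symm_apply_val, ← ofDigitVec_eq_finFunctionFinEquiv hd] at h1
  exact h1

theorem ofDigitVec_digit {a p r : ℕ} (hr : r < p ^ a) :
    ofDigitVec p (fun k : Fin a => digit p k r) = r := by
  have h := congrArg Fin.val (finFunctionFinEquiv.apply_symm_apply (⟨r, hr⟩ : Fin (p ^ a)))
  rw [finFunctionFinEquiv_apply] at h
  refine Eq.trans (Finset.sum_congr rfl fun k _ => ?_) h
  rw [finFunctionFinEquiv_symm_apply_val, mul_comm]
  rfl

variable {n N a : ℕ} (p : ℕ) (A : Fin N → Fin n → ℤ)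

/-- The element `∑_{k,j} p^k d_{kj} a_j` of `ℤⁿ`. -/
def latticeSum (d : Fin a → Fin N → ℕ) : Fin n → ℤ :=
  ∑ k : Fin a, p ^ (k : ℕ) • ∑ j, d k j • A j

theorem latticeSum_add (d d' : Fin a → Fin N → ℕ) :
    latticeSum p A (d + d') = latticeSum p A d + latticeSum p A d' := by
  simp [latticeSum, add_smul, Finset.sum_add_distrib]

theorem sum_pi_single_smul (j : Fin N) (c : ℕ) :
    ∑ i, (Pi.single j c : Fin N → ℕ) i • A i = c • A j := by
  rw [Finset.sum_eq_single j]
  · simp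
  · intro i _ hi
    simp [hi]
  · simp

theorem latticeSum_single (k : Fin a) (j : Fin N) (c : ℕ) :
    latticeSum p A (Pi.single k (Pi.single j c)) = p ^ (k : ℕ) • c • A j := by
  rw [latticeSum, Finset.sum_eq_single k]
  · rw [Pi.single_eq_same, sum_pi_single_smul]
  · intro i _ hi
    simp [Pi.single_eq_of_ne hi]
  · simp

theorem sum_sum_single (k : Fin a) (j : Fin N) (c : ℕ) :
    ∑ i, ∑ l, (Pi.single k (Pi.single j c) : Fin a → Fin N → ℕ) i l = c := by
  rw [Finset.sum_eq_single k]
  · rw [Pi.single_eq_same, Finset.sum_pi_single']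
    simp
  · intro i _ hi
    simp [Pi.single_eq_of_ne hi]
  · simp

theorem latticeSum_eq_sum_ofDigitVec (d : Fin a → Fin N → ℕ) :
    latticeSum p A d = ∑ j, ofDigitVec p (fun k => d k j) • A j := by
  simp only [latticeSum, ofDigitVec, Finset.smul_sum, Finset.sum_smul, mul_smul]
  exact Finset.sum_comm

variable {p A}

theorem add_mem_twistCoset {q : ℕ} {e m : Fin n → ℤ} (hm : m ∈ twistCoset q e) {c : ℤ}
    (hc : (q : ℤ) - 1 ∣ c) (v : Fin n → ℤ) : m + c • v ∈ twistCoset q e := by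
  obtain ⟨t, rfl⟩ := hm
  obtain ⟨s, rfl⟩ := hc
  refine ⟨t + s • v, ?_⟩
  rw [smul_add, mul_smul, add_assoc]

/-- The place after the top one is `p^a = q ≡ 1`, that is, place zero again. -/
theorem exists_cyclic_succ (p : ℕ) (k : Fin a) :
    ∃ k' : Fin a, (((p ^ a : ℕ) : ℤ) - 1) ∣ (p : ℤ) ^ (k' : ℕ) - (p : ℤ) ^ ((k : ℕ) + 1) := by
  by_cases h : (k : ℕ) + 1 < a
  · exact ⟨⟨k + 1, h⟩, by simp⟩
  · refine ⟨⟨0, by have := k.2; omega⟩, ?_⟩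
    have h1 : (k : ℕ) + 1 = a := by have := k.2; omega
    rw [h1]
    refine ⟨-1, ?_⟩
    push_cast
    ring

theorem mem_UM_of_digits (hp : 0 < p) {M : Set (Fin n → ℤ)} {d : Fin a → Fin N → ℕ}
    (hd : ∀ k j, d k j ≤ p - 1) (hM : latticeSum p A d ∈ M) :
    (fun j => ofDigitVec p fun k => d k j) ∈ UM p a A M := by
  refine ⟨fun j => ?_, ?_⟩
  · exact Nat.le_sub_one_of_lt (ofDigitVec_lt fun k => by have := hd k j; omega)
  · rwa [latticeSum_eq_sum_ofDigitVec] at hM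

theorem pWeight_ofDigitVec (hp : 0 < p) {d : Fin a → Fin N → ℕ} (hd : ∀ k j, d k j ≤ p - 1) :
    pWeight p a (fun j => ofDigitVec p fun k => d k j) = ∑ k, ∑ j, d k j := by
  rw [pWeight, Finset.sum_comm]
  refine Finset.sum_congr rfl fun k _ => Finset.sum_congr rfl fun j _ => ?_
  exact digit_ofDigitVec (d := fun k => d k j) (fun k => by have := hd k j; omega) k

theorem pWeightSet_le {M : Set (Fin n → ℤ)} {u : Fin N → ℕ} (hu : u ∈ UM p a A M) :
    pWeightSet p a A M ≤ pWeight p a u := Nat.sInf_le ⟨u, hu, rfl⟩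

/-- Carrying: a generalized digit array representing an element of `M` has size at least
`w_p(M)`, and arrays of size `w_p(M)` consist of actual digits. -/
theorem pWeightSet_le_sum (hp : 1 < p) {e : Fin n → ℤ} {M : Set (Fin n → ℤ)}
    (hM : M = twistCoset (p ^ a) e) (d : Fin a → Fin N → ℕ) (hd : latticeSum p A d ∈ M) :
    pWeightSet p a A M ≤ ∑ k, ∑ j, d k j ∧
      (∑ k, ∑ j, d k j = pWeightSet p a A M → ∀ k j, d k j ≤ p - 1) := by
  induction hs : ∑ k, ∑ j, d k j using Nat.strong_induction_on generalizing d with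
  | _ s ih =>
    by_cases hdig : ∀ k j, d k j ≤ p - 1
    · refine ⟨?_, fun _ => hdig⟩
      rw [← hs, ← pWeight_ofDigitVec (by omega) hdig]
      exact pWeightSet_le (mem_UM_of_digits (by omega) hdig hd)
    · push Not at hdig
      obtain ⟨k, j, hkj⟩ := hdig
      obtain ⟨k', hk'⟩ := exists_cyclic_succ p k
      -- The carry replaces `δ`, `p` copies of `a_j` at place `k`, by `δ'`, one copy at the
      -- cyclically next place. The size drops by `p - 1 > 0`, so the induction hypothesis applies,
      -- and the bound for an array with an oversized entry is strict.
      set δ : Fin a → Fin N → ℕ := Pi.single k (Pi.single j p) with hδ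
      set δ' : Fin a → Fin N → ℕ := Pi.single k' (Pi.single j 1) with hδ'
      have hle : δ ≤ d := by
        intro k₁ j₁
        by_cases hk : k₁ = k
        · subst hk
          by_cases hj : j₁ = j
          · subst hj
            simp [hδ]
            omega
          · simp [hδ, Pi.single_eq_of_ne hj]
        · simp [hδ, Pi.single_eq_of_ne hk]
      obtain ⟨b, rfl⟩ : ∃ b, d = b + δ := ⟨d - δ, (tsub_add_cancel_of_le hle).symm⟩
      have hsum : ∀ c c' : Fin a → Fin N → ℕ, ∑ k, ∑ j, (c + c') k j =
          ∑ k, ∑ j, c k j + ∑ k, ∑ j, c' k j := by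
        intro c c'
        simp [Finset.sum_add_distrib]
      have h1 : latticeSum p A (b + δ') ∈ M := by
        have h2 : latticeSum p A (b + δ') = latticeSum p A (b + δ) +
            ((p : ℤ) ^ (k' : ℕ) - (p : ℤ) ^ ((k : ℕ) + 1)) • A j := by
          rw [latticeSum_add, latticeSum_add, hδ, hδ', latticeSum_single, latticeSum_single]
          ext i
          simp
          ring
        rw [h2, hM]
        rw [hM] at hd
        exact add_mem_twistCoset hd hk' _
      rw [hsum, hδ, sum_sum_single] at hs
      have h3 := (ih _ (by rw [hsum, hδ', sum_sum_single]; omega) (b + δ') h1 rfl).1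
      rw [hsum, hδ', sum_sum_single] at h3
      exact ⟨by omega, fun h => by omega⟩

/-- The vector `∑_j u_j^{(k)} a_j` obtained from the `k`-th digits of `u`. -/
def digitLattice (p a : ℕ) (A : Fin N → Fin n → ℤ) (u : Fin N → ℕ) (k : Fin a) : Fin n → ℤ :=
  ∑ j, digit p k (u j) • A j

theorem sum_digitLattice {u : Fin N → ℕ} (hu : ∀ j, u j < p ^ a) :
    ∑ k : Fin a, p ^ (k : ℕ) • digitLattice p a A u k = ∑ j, u j • A j := by
  refine (latticeSum_eq_sum_ofDigitVec p A fun (k : Fin a) j => digit p k (u j)).trans ?_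
  exact Finset.sum_congr rfl fun j _ => by rw [ofDigitVec_digit (hu j)]

theorem sum_digits_eq_pWeight (p a : ℕ) (u : Fin N → ℕ) :
    ∑ k : Fin a, ∑ j, digit p k (u j) = pWeight p a u := Finset.sum_comm

/-! ### Digit rows of the elements of minimal `p`-weight -/

section Minimal

variable {e : Fin n → ℤ} {M : Set (Fin n → ℤ)} {u : Fin N → ℕ}

theorem lt_of_mem_UM (hp : 0 < p) (hu : u ∈ UM p a A M) (j : Fin N) : u j < p ^ a :=
  (Nat.lt_iff_le_pred (pow_pos hp a)).2 (hu.1 j)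

/-- Replacing the `k`-th digit row of `u` by another representation `v` of the same vector leaves
the represented element of `M` unchanged. The carrying bound for the new array, compared with the
size `w_p(M)` of the old one, isolates row `k`. -/
theorem sum_digits_le_of_mem_Uplus (hp : 1 < p) (hM : M = twistCoset (p ^ a) e)
    (hu : u ∈ UMMin p a A M) (k : Fin a) {v : Fin N → ℕ}
    (hv : v ∈ Uplus A (digitLattice p a A u k)) :
    ∑ j, digit p k (u j) ≤ ∑ j, v j ∧
      (∑ j, v j = ∑ j, digit p k (u j) → ∀ j, v j ≤ p - 1) := by
  classical
  set d : Fin a → Fin N → ℕ := fun k j => digit p k (u j) with hd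
  have h1 : latticeSum p A (Function.update d k v) = latticeSum p A d := by
    refine Finset.sum_congr rfl fun i _ => ?_
    rcases eq_or_ne i k with rfl | hi
    · rw [Function.update_self, show ∑ j, v j • A j = _ from hv]
      rfl
    · rw [Function.update_of_ne hi]
  have h2 : latticeSum p A d ∈ M := by
    have h : latticeSum p A d = ∑ j, u j • A j :=
      sum_digitLattice (lt_of_mem_UM (by omega) hu.1)
    rw [h]
    exact hu.1.2
  have h3 := pWeightSet_le_sum hp hM (Function.update d k v) (h1 ▸ h2)
  have h4 : ∑ i, ∑ j, Function.update d k v i j =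
      ∑ j, v j + ∑ i ∈ Finset.univ.erase k, ∑ j, d i j := by
    rw [← Finset.add_sum_erase _ _ (Finset.mem_univ k), Function.update_self]
    congr 1
    refine Finset.sum_congr rfl fun i hi => ?_
    rw [Function.update_of_ne (Finset.ne_of_mem_erase hi)]
  have h5 : ∑ i, ∑ j, d i j = ∑ j, d k j + ∑ i ∈ Finset.univ.erase k, ∑ j, d i j :=
    (Finset.add_sum_erase _ _ (Finset.mem_univ k)).symm
  have h6 : ∑ i, ∑ j, d i j = pWeightSet p a A M := (sum_digits_eq_pWeight p a u).trans hu.2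
  have h7 : ∑ j, digit p k (u j) = ∑ j, d k j := rfl
  refine ⟨by omega, fun h j => ?_⟩
  have h8 := h3.2 (by omega) k j
  rwa [Function.update_self] at h8

theorem weight_digitLattice (hp : 1 < p) (hM : M = twistCoset (p ^ a) e)
    (hu : u ∈ UMMin p a A M) (k : Fin a) :
    weight A (digitLattice p a A u k) = ∑ j, digit p k (u j) := by
  have h0 : (fun j => digit p k (u j)) ∈ Uplus A (digitLattice p a A u k) := rfl
  refine le_antisymm (Nat.sInf_le ⟨_, h0, rfl⟩) ?_
  obtain ⟨v, hv⟩ := uplusMin_nonempty (A := A) ⟨_, h0⟩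
  rw [← hv.2]
  exact (sum_digits_le_of_mem_Uplus hp hM hu k hv.1).1

theorem digits_mem_UplusMin (hp : 1 < p) (hM : M = twistCoset (p ^ a) e)
    (hu : u ∈ UMMin p a A M) (k : Fin a) :
    (fun j => digit p k (u j)) ∈ UplusMin A (digitLattice p a A u k) :=
  ⟨rfl, (weight_digitLattice hp hM hu k).symm⟩

theorem digitLattice_mem_Gam (hp : 1 < p) (hM : M = twistCoset (p ^ a) e)
    (hu : u ∈ UMMin p a A M) : digitLattice p a A u ∈ Gam p a A M := by
  refine ⟨fun k => ⟨⟨_, (digits_mem_UplusMin hp hM hu k).1⟩, fun v hv => ?_⟩, ?_, ?_⟩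
  · exact (sum_digits_le_of_mem_Uplus hp hM hu k hv.1).2
      (hv.2.trans (weight_digitLattice hp hM hu k))
  · rw [sum_digitLattice (lt_of_mem_UM (by omega) hu.1)]
    exact hu.1.2
  · rw [Finset.sum_congr rfl fun k _ => weight_digitLattice hp hM hu k, sum_digits_eq_pWeight]
    exact hu.2.symm

/-- Goodness makes all entries genuine digits, so assembling the rows involves no carries and the
`p`-weight is the sum of the `w(γ_k)`. -/
theorem ofDigitVec_mem_UMMin (hp : 0 < p) {γ : Fin a → Fin n → ℤ} (hγ : γ ∈ Gam p a A M)
    {d : Fin a → Fin N → ℕ} (hd : ∀ k, d k ∈ UplusMin A (γ k)) :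
    (fun j => ofDigitVec p fun k => d k j) ∈ UMMin p a A M := by
  have hdig : ∀ k j, d k j ≤ p - 1 := fun k j => (hγ.1 k).2 _ (hd k) j
  refine ⟨mem_UM_of_digits hp hdig ?_, ?_⟩
  · have h : latticeSum p A d = ∑ k : Fin a, p ^ (k : ℕ) • γ k :=
      Finset.sum_congr rfl fun k _ => by rw [show ∑ j, d k j • A j = _ from (hd k).1]
    rw [h]
    exact hγ.2.1
  · rw [pWeight_ofDigitVec hp hdig, hγ.2.2]
    exact Finset.sum_congr rfl fun k _ => (hd k).2

end Minimal

end Carrying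

/-! ### The product formula -/

section ProductFormula

theorem prod_monomial {σ R ι : Type*} [CommSemiring R] (s : Finset ι) (m : ι → σ →₀ ℕ)
    (c : ι → R) : ∏ k ∈ s, MvPolynomial.monomial (m k) (c k) =
      MvPolynomial.monomial (∑ k ∈ s, m k) (∏ k ∈ s, c k) := by
  classical
  induction s using Finset.induction_on with
  | empty => simp
  | insert i s hi ih =>
    rw [Finset.prod_insert hi, ih, MvPolynomial.monomial_mul, Finset.sum_insert hi,
      Finset.prod_insert hi]

variable {n N a : ℕ} {p : ℕ} [Fact p.Prime] {A : Fin N → Fin n → ℤ}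

/-- Substituting `λ^{p^k}` multiplies exponents by `p^k`, so one monomial chosen from each factor
supplies the digits of the product's exponents. -/
theorem prod_expand_F (γ : Fin a → Fin n → ℤ) :
    ∏ k : Fin a, MvPolynomial.expand (p ^ (k : ℕ)) (F p A (γ k)) =
      ∑ d ∈ Fintype.piFinset fun k => (uplusMin_finite A (γ k)).toFinset,
        MvPolynomial.monomial
          (Finsupp.equivFunOnFinite.symm fun j => ofDigitVec p fun k => d k j)
          (∏ k, ∏ j, ((d k j).factorial : ZMod p))⁻¹ := by
  simp only [F, map_sum, MvPolynomial.expand_monomial]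
  rw [Finset.prod_univ_sum]
  refine Finset.sum_congr rfl fun d _ => ?_
  have h : ∑ k : Fin a, p ^ (k : ℕ) • Finsupp.equivFunOnFinite.symm (d k) =
      Finsupp.equivFunOnFinite.symm fun j => ofDigitVec p fun k => d k j := by
    ext j
    simp [ofDigitVec, Finsupp.finsetSum_apply]
  rw [prod_monomial, Finset.prod_inv_distrib, h]

/-- Group the minimal `u` by the vectors their digit rows represent: taking digits identifies the
fibre over `γ` with the product of the `U⁺_min(γ_k)`. -/
theorem sum_UMMin_eq_sum_Gam {e : Fin n → ℤ} {M : Set (Fin n → ℤ)}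
    (hM : M = twistCoset (p ^ a) e) :
    ∑ u ∈ (umMin_finite p a A M).toFinset,
        MvPolynomial.monomial (Finsupp.equivFunOnFinite.symm u)
          (∏ j, ∏ k : Fin a, ((digit p k (u j)).factorial : ZMod p))⁻¹ =
      ∑ γ ∈ (gam_finite p a A M).toFinset,
        ∏ k : Fin a, MvPolynomial.expand (p ^ (k : ℕ)) (F p A (γ k)) := by
  classical
  have hp := (Fact.out : p.Prime).one_lt
  have hp0 := (Fact.out : p.Prime).pos
  rw [← Finset.sum_fiberwise_of_maps_to (g := digitLattice p a A)
    (t := (gam_finite p a A M).toFinset)]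
  · refine Finset.sum_congr rfl fun γ hγ => ?_
    rw [Set.Finite.mem_toFinset] at hγ
    rw [prod_expand_F]
    refine Finset.sum_bij' (fun u _ (k : Fin a) j => digit p k (u j))
      (fun d _ j => ofDigitVec p fun k => d k j) ?_ ?_ ?_ ?_ ?_
    · intro u hu
      rw [Finset.mem_filter, Set.Finite.mem_toFinset] at hu
      obtain ⟨hu, rfl⟩ := hu
      rw [Fintype.mem_piFinset]
      exact fun k => (Set.Finite.mem_toFinset _).2 (digits_mem_UplusMin hp hM hu k)
    · intro d hd
      simp only [Fintype.mem_piFinset, Set.Finite.mem_toFinset] at hd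
      rw [Finset.mem_filter, Set.Finite.mem_toFinset]
      refine ⟨ofDigitVec_mem_UMMin hp0 hγ hd, ?_⟩
      ext1 k
      rw [digitLattice, ← show ∑ j, d k j • A j = γ k from (hd k).1]
      refine Finset.sum_congr rfl fun j _ => ?_
      rw [digit_ofDigitVec (d := fun k => d k j) fun k => ?_]
      have := (hγ.1 k).2 _ (hd k) j
      omega
    · intro u hu
      rw [Finset.mem_filter, Set.Finite.mem_toFinset] at hu
      ext j
      exact ofDigitVec_digit (lt_of_mem_UM hp0 hu.1.1 j)
    · intro d hd
      simp only [Fintype.mem_piFinset, Set.Finite.mem_toFinset] at hd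
      ext k j
      refine digit_ofDigitVec (d := fun k => d k j) (fun k => ?_) k
      have := (hγ.1 k).2 _ (hd k) j
      omega
    · intro u hu
      rw [Finset.mem_filter, Set.Finite.mem_toFinset] at hu
      rw [Finset.prod_comm]
      congr 2
      ext j
      exact (ofDigitVec_digit (lt_of_mem_UM hp0 hu.1.1 j)).symm
  · intro u hu
    rw [Set.Finite.mem_toFinset] at hu ⊢
    exact digitLattice_mem_Gam hp hM hu

end ProductFormula

/-! ### Expansion of the exponential sum -/

section Expansion

theorem addChar_map_sum {G R σ : Type*} [AddCommMonoid G] [CommMonoid R] (ψ : AddChar G R)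
    (s : Finset σ) (f : σ → G) : ψ (∑ i ∈ s, f i) = ∏ i ∈ s, ψ (f i) := by
  classical
  induction s using Finset.induction_on with
  | empty => simp
  | insert i s hi ih => rw [Finset.sum_insert hi, Finset.prod_insert hi, ψ.map_add_eq_mul, ih]

theorem zpow_finset_sum {F σ : Type*} [Field F] {x : F} (hx : x ≠ 0) (s : Finset σ) (f : σ → ℤ) :
    x ^ (∑ i ∈ s, f i) = ∏ i ∈ s, x ^ f i := by
  classical
  induction s using Finset.induction_on with
  | empty => simp
  | insert i s hi ih => rw [Finset.sum_insert hi, Finset.prod_insert hi, zpow_add₀ hx, ih]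

open Classical

variable {n N : ℕ} {p : ℕ} [Fact p.Prime] {K : Type*} [Field K] [Fintype K]
  (ι : K →+* residueField p)

/-- The powers of `ω(x_i)` collect to the exponent vector `∑ u_j a_j - e`, and orthogonality keeps
it only if `q-1` divides every coordinate. -/
theorem expSum_eq_sum_fourierCoeff (Ψ : AddChar K (PadicAlgCl p)) (hΨ : Ψ ≠ 1)
    (A : Fin N → Fin n → ℤ) (e : Fin n → ℤ) (l : Fin N → K) :
    expSum ι Ψ A e l =
      ∑ u ∈ Fintype.piFinset fun _ : Fin N => Finset.range (Fintype.card K),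
        (∏ j, fourierCoeff ι Ψ (u j) * teichmullerHom ι (l j) ^ u j) *
          if ∑ j, u j • A j ∈ twistCoset (Fintype.card K) e then
            ((Fintype.card K : PadicAlgCl p) - 1) ^ n else 0 := by
  have h1 : ∀ x : Fin n → Kˣ,
      (∏ i, teichmuller ι (x i : K) ^ (-e i)) * Ψ (laurentEval A l x) =
      ∑ u ∈ Fintype.piFinset fun _ : Fin N => Finset.range (Fintype.card K),
        (∏ j, fourierCoeff ι Ψ (u j) * teichmullerHom ι (l j) ^ u j) *
          ∏ i, teichmullerHom ι (x i : K) ^ ((∑ j, u j • A j) i - e i) := by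
    intro x
    rw [laurentEval, addChar_map_sum,
      Finset.prod_congr rfl fun j _ => addChar_eq_sum_fourierCoeff ι Ψ hΨ _, Finset.prod_univ_sum,
      Finset.mul_sum]
    refine Finset.sum_congr rfl fun u _ => ?_
    have h2 : ∀ i, teichmullerHom ι (x i : K) ^ ((∑ j, u j • A j) i - e i) =
        (∏ j, teichmullerHom ι (x i : K) ^ ((u j : ℤ) * A j i)) *
          teichmullerHom ι (x i : K) ^ (-e i) := by
      intro i
      rw [sub_eq_add_neg, zpow_add₀ (teichmuller_unit_ne_zero ι _), Finset.sum_apply,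
        zpow_finset_sum (teichmuller_unit_ne_zero ι _)]
      simp
    have h3 : ∀ j, teichmullerHom ι (l j * ∏ i, (x i : K) ^ A j i) ^ u j =
        teichmullerHom ι (l j) ^ u j *
          ∏ i, teichmullerHom ι (x i : K) ^ ((u j : ℤ) * A j i) := by
      intro j
      rw [map_mul, mul_pow, map_prod, ← Finset.prod_pow]
      congr 1
      refine Finset.prod_congr rfl fun i _ => ?_
      rw [map_zpow₀, mul_comm, zpow_mul, zpow_natCast]
    simp only [h2, h3, Finset.prod_mul_distrib]
    rw [Finset.prod_comm (s := (Finset.univ : Finset (Fin N)))]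
    simp only [teichmullerHom_apply]
    ring
  rw [expSum, Finset.sum_congr rfl fun x _ => h1 x, Finset.sum_comm]
  refine Finset.sum_congr rfl fun u _ => ?_
  rw [← Finset.mul_sum, sum_prod_units_teichmuller_zpow]
  congr 1
  refine if_congr ?_ rfl rfl
  constructor
  · intro h
    choose t ht using h
    refine ⟨t, ?_⟩
    ext i
    rw [Pi.add_apply, Pi.smul_apply, smul_eq_mul, ← ht i]
    ring
  · rintro ⟨t, ht⟩ i
    refine ⟨t i, ?_⟩
    rw [ht, Pi.add_apply, Pi.smul_apply, smul_eq_mul]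
    ring

variable {π : PadicAlgCl p} (hπ : π ^ (p - 1) = -(p : PadicAlgCl p)) [Algebra (ZMod p) K]
  {ζ : PadicAlgCl p} (hζ : ζ ^ p = 1)

include hπ in
-- Divided by `π` to the digit sum, each coefficient is integral and congruent to a unit modulo `π`.
-- Such congruences multiply, and the removed powers of `π` combine to `π^{w_p(u)}`.
theorem norm_monomial_term_sub_le {a : ℕ} (hK : Fintype.card K = p ^ a)
    (hζπ : CongrModPow p π 2 ζ (1 + π)) (n : ℕ) (l : Fin N → K) {u : Fin N → ℕ}
    (hu : ∀ j, u j < Fintype.card K) :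
    ‖(∏ j, fourierCoeff ι (additiveChar K hζ) (u j) * teichmullerHom ι (l j) ^ u j) *
        ((Fintype.card K : PadicAlgCl p) - 1) ^ n -
      (∏ j, (digitFactorial p a (u j) : PadicAlgCl p)⁻¹ * teichmullerHom ι (l j) ^ u j) *
        (-1) ^ n * π ^ pWeight p a u‖ ≤ ‖π‖ ^ (pWeight p a u + 1) := by
  have hπ0 := uniformizer_ne_zero hπ
  have hπ1 := norm_uniformizer_lt_one hπ
  set c := fun j => fourierCoeff ι (additiveChar K hζ) (u j) / π ^ digitSum p a (u j) with hc
  set g := fun j => (digitFactorial p a (u j) : PadicAlgCl p)⁻¹ with hg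
  have hcg : ∀ j, ‖c j - g j‖ ≤ ‖π‖ := fun j =>
    norm_fourierCoeff_div_sub_le ι hπ hζ hK hζπ (hu j)
  have hg1 : ∀ j, ‖g j‖ = 1 := fun j => by simp only [hg, norm_inv, norm_digitFactorial, inv_one]
  have hc1 : ∀ j, ‖c j‖ ≤ 1 := fun j => by
    have h := norm_add_le_of_le ((hcg j).trans hπ1.le) (hg1 j).le
    rwa [sub_add_cancel] at h
  have hω : ∀ j, ‖teichmullerHom ι (l j) ^ u j‖ ≤ 1 := fun j => by
    rw [norm_pow]
    exact pow_le_one₀ (norm_nonneg _) (norm_teichmuller_le_one ι _)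
  have hprod : ‖(∏ j, c j * teichmullerHom ι (l j) ^ u j) -
      ∏ j, g j * teichmullerHom ι (l j) ^ u j‖ ≤ ‖π‖ := by
    refine norm_prod_sub_prod_le (norm_nonneg _) (fun j _ => norm_mul_le_of_le (hc1 j) (hω j))
      (fun j _ => norm_mul_le_of_le (hg1 j).le (hω j)) fun j _ => ?_
    rw [← sub_mul]
    exact norm_mul_le_of_le (hcg j) (hω j)
  have hsign : ‖((Fintype.card K : PadicAlgCl p) - 1) ^ n - (-1) ^ n‖ ≤ ‖π‖ := by
    refine norm_pow_sub_pow_le (norm_nonneg _) (norm_card_sub_one ι).le (by simp) ?_ n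
    rw [sub_neg_eq_add, sub_add_cancel]
    exact (norm_card_le ι).trans (norm_prime_le_uniformizer hπ)
  have hall := norm_mul_sub_mul_le hprod hsign
    (by rw [norm_pow, norm_card_sub_one ι, one_pow])
    (norm_prod_le_one fun j _ => norm_mul_le_of_le (hg1 j).le (hω j))
  have hcπ : ∏ j, fourierCoeff ι (additiveChar K hζ) (u j) * teichmullerHom ι (l j) ^ u j =
      (∏ j, c j * teichmullerHom ι (l j) ^ u j) * π ^ pWeight p a u := by
    rw [pWeight_eq_sum_digitSum, ← Finset.prod_pow_eq_pow_sum, ← Finset.prod_mul_distrib]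
    refine Finset.prod_congr rfl fun j _ => ?_
    simp only [hc]
    field_simp
  rw [hcπ, pow_succ', mul_right_comm, ← sub_mul, norm_mul, norm_pow]
  exact mul_le_mul_of_nonneg_right hall (by positivity)

theorem aeval_hasseLift {a : ℕ} (A : Fin N → Fin n → ℤ) (M : Set (Fin n → ℤ))
    (x : Fin N → PadicAlgCl p) :
    MvPolynomial.aeval x (hasseLift p a A M) = ∑ u ∈ (umMin_finite p a A M).toFinset,
      (∏ j, (digitFactorial p a (u j) : PadicAlgCl p)⁻¹ * x j ^ u j) * (-1) ^ n := by
  rw [hasseLift, map_mul, map_pow, map_neg, map_one, map_sum, Finset.mul_sum]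
  refine Finset.sum_congr rfl fun u _ => ?_
  rw [MvPolynomial.aeval_monomial, mul_comm, Finset.prod_mul_distrib, Finset.prod_inv_distrib,
    Finsupp.prod_fintype _ _ (by simp)]
  congr 2
  rw [map_inv₀, map_prod]
  congr 1
  refine Finset.prod_congr rfl fun j _ => ?_
  simp [digitFactorial]

include hπ in
theorem norm_expSum_sub_le {a : ℕ} (hK : Fintype.card K = p ^ a)
    (hζπ : CongrModPow p π 2 ζ (1 + π)) (A : Fin N → Fin n → ℤ) (e : Fin n → ℤ)
    {M : Set (Fin n → ℤ)} (hM : M = twistCoset (p ^ a) e) (l : Fin N → K) :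
    ‖expSum ι (additiveChar K hζ) A e l -
      MvPolynomial.aeval (fun j => teichmuller ι (l j)) (hasseLift p a A M) *
        π ^ pWeightSet p a A M‖ ≤ ‖π‖ ^ (pWeightSet p a A M + 1) := by
  have hπ1 := (norm_uniformizer_lt_one hπ).le
  have hp0 := (Fact.out : p.Prime).pos
  have hsub : (umMin_finite p a A M).toFinset ⊆
      Fintype.piFinset fun _ : Fin N => Finset.range (Fintype.card K) := by
    intro u hu
    rw [Set.Finite.mem_toFinset] at hu
    rw [Fintype.mem_piFinset]
    intro j
    rw [Finset.mem_range, hK]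
    exact lt_of_mem_UM hp0 hu.1 j
  have hfilter : (umMin_finite p a A M).toFinset =
      (Fintype.piFinset fun _ : Fin N => Finset.range (Fintype.card K)).filter
        (· ∈ UMMin p a A M) := by
    ext u
    rw [Finset.mem_filter, Set.Finite.mem_toFinset]
    exact ⟨fun h => ⟨hsub ((Set.Finite.mem_toFinset _).2 h), h⟩, fun h => h.2⟩
  rw [expSum_eq_sum_fourierCoeff ι _ (additiveChar_ne_one hπ hζ hζπ), aeval_hasseLift,
    Finset.sum_mul, hfilter, Finset.sum_filter, ← Finset.sum_sub_distrib]
  refine norm_finset_sum_le (by positivity) fun u hu => ?_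
  simp only [Fintype.mem_piFinset, Finset.mem_range] at hu
  have hterm := norm_monomial_term_sub_le ι hπ hζ hK hζπ n l hu
  rw [hK, ← hM]
  by_cases huM : ∑ j, u j • A j ∈ M
  · have huU : u ∈ UM p a A M := ⟨fun j => Nat.le_sub_one_of_lt (hK ▸ hu j), huM⟩
    rw [if_pos huM]
    rw [hK] at hterm
    by_cases hmin : u ∈ UMMin p a A M
    · rw [if_pos hmin]
      rw [hmin.2] at hterm
      exact hterm
    -- Here `w_p(u) > w_p(M)`, so both the main part of the term and its error are within the bound.
    · rw [if_neg hmin, sub_zero]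
      have hle := pWeightSet_le huU
      have hne : pWeight p a u ≠ pWeightSet p a A M := fun h => hmin ⟨huU, h⟩
      set m := (∏ j, (digitFactorial p a (u j) : PadicAlgCl p)⁻¹ *
        teichmullerHom ι (l j) ^ u j) * (-1) ^ n with hm
      have hm1 : ‖m‖ ≤ 1 := by
        refine norm_mul_le_of_le (norm_prod_le_one fun j _ => norm_mul_le_of_le ?_ ?_) (by simp)
        · rw [norm_inv, norm_digitFactorial, inv_one]
        · rw [norm_pow]
          exact pow_le_one₀ (norm_nonneg _) (norm_teichmuller_le_one ι _)
      have h1 : ‖π ^ pWeight p a u * m‖ ≤ ‖π‖ ^ (pWeightSet p a A M + 1) := by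
        refine norm_mul_le_of_le ?_ hm1
        rw [norm_pow]
        exact pow_le_pow_of_le_one (norm_nonneg _) hπ1 (by omega)
      have h2 := norm_add_le_of_le
        (hterm.trans (pow_le_pow_of_le_one (norm_nonneg _) hπ1 (by omega))) h1
      rwa [mul_comm (π ^ pWeight p a u), sub_add_cancel] at h2
  · rw [if_neg huM, if_neg fun h => huM h.1.2]
    simp only [mul_zero, sub_zero, norm_zero]
    positivity

end Expansion

/-! ### Reduction of polynomials modulo `p` -/

section Reduction

variable {N : ℕ} {p : ℕ} [Fact p.Prime]

theorem coeff_reduceMod (P : MvPolynomial (Fin N) ℚ) (m : Fin N →₀ ℕ) :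
    (reduceMod p P).coeff m = ((P.coeff m : ℚ) : ZMod p) := by
  classical
  rw [reduceMod, MvPolynomial.coeff_sum]
  simp only [MvPolynomial.coeff_monomial]
  rw [Finset.sum_ite_eq']
  split_ifs with h
  · rfl
  · rw [MvPolynomial.notMem_support_iff.1 h, Rat.cast_zero]

theorem coeff_sum_monomial {R : Type*} [CommSemiring R] (s : Finset (Fin N → ℕ))
    (r : (Fin N → ℕ) → R) (m : Fin N →₀ ℕ) [Decidable (⇑m ∈ s)] :
    (∑ u ∈ s, MvPolynomial.monomial (Finsupp.equivFunOnFinite.symm u) (r u)).coeff m =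
      if ⇑m ∈ s then r m else 0 := by
  classical
  rw [MvPolynomial.coeff_sum]
  simp only [MvPolynomial.coeff_monomial]
  have h : ∀ u : Fin N → ℕ, Finsupp.equivFunOnFinite.symm u = m ↔ u = ⇑m := by
    intro u
    rw [Equiv.symm_apply_eq]
    rfl
  simp only [h]
  rw [Finset.sum_ite_eq']
  congr

omit [Fact p.Prime] in
theorem not_dvd_den_divInt {z : ℤ} {b : ℕ} (hb : ¬ p ∣ b) : ¬ p ∣ ((z : ℚ) / (b : ℚ)).den := by
  intro h
  have h1 := Rat.den_dvd z b
  rw [Rat.divInt_eq_div] at h1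
  push_cast at h1
  exact hb (h.trans (Int.natCast_dvd_natCast.1 h1))

theorem cast_div_natCast_zmod {z : ℤ} {b : ℕ} (hb : ¬ p ∣ b) :
    (((z : ℚ) / (b : ℚ) : ℚ) : ZMod p) = z / b := by
  have h : ((b : ℤ) : ZMod p) ≠ 0 := by
    rwa [Int.cast_natCast, Ne, ZMod.natCast_eq_zero_iff]
  have h1 := Rat.cast_divInt_of_ne_zero (α := ZMod p) z h
  rw [Rat.divInt_eq_div] at h1
  exact_mod_cast h1

theorem not_dvd_digitFactorial (a r : ℕ) : ¬ p ∣ digitFactorial p a r := by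
  intro h
  have h1 := norm_natCast_le_of_dvd h
  rw [norm_digitFactorial] at h1
  exact absurd prime_norm_lt_one (not_lt.2 h1)

theorem not_dvd_prod_digitFactorial (a : ℕ) (u : Fin N → ℕ) :
    ¬ p ∣ ∏ j, digitFactorial p a (u j) := by
  rw [Prime.dvd_finsetProd_iff (Fact.out : p.Prime).prime]
  rintro ⟨j, _, h⟩
  exact not_dvd_digitFactorial a _ h

variable {n : ℕ} (a : ℕ) (A : Fin N → Fin n → ℤ) (M : Set (Fin n → ℤ))

omit [Fact p.Prime] in
theorem hasseLift_eq : hasseLift p a A M = ∑ u ∈ (umMin_finite p a A M).toFinset,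
    MvPolynomial.monomial (Finsupp.equivFunOnFinite.symm u)
      ((((-1) ^ n : ℤ) : ℚ) / ((∏ j, digitFactorial p a (u j) : ℕ) : ℚ)) := by
  rw [hasseLift, Finset.mul_sum]
  refine Finset.sum_congr rfl fun u _ => ?_
  have h : ((-1) ^ n : MvPolynomial (Fin N) ℚ) = MvPolynomial.C ((-1) ^ n) := by simp
  rw [h, MvPolynomial.C_mul_monomial, div_eq_mul_inv]
  congr 3
  · push_cast
    rfl
  · push_cast [digitFactorial]
    rfl

theorem isPIntegral_hasseLift : IsPIntegral p (hasseLift p a A M) := by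
  classical
  intro m
  rw [hasseLift_eq, coeff_sum_monomial]
  split_ifs
  · exact not_dvd_den_divInt (not_dvd_prod_digitFactorial a _)
  · simpa using (Fact.out : p.Prime).one_lt.ne'

theorem hasseInvariant_eq : hasseInvariant p a A M =
    (-1) ^ n * ∑ u ∈ (umMin_finite p a A M).toFinset,
      MvPolynomial.monomial (Finsupp.equivFunOnFinite.symm u)
        (∏ j, ∏ k : Fin a, ((digit p k (u j)).factorial : ZMod p))⁻¹ := by
  classical
  have h : ((-1) ^ n : MvPolynomial (Fin N) (ZMod p)) = MvPolynomial.C ((-1) ^ n) := by simp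
  ext m
  rw [hasseInvariant, coeff_reduceMod, hasseLift_eq, coeff_sum_monomial, h,
    MvPolynomial.coeff_C_mul, coeff_sum_monomial]
  split_ifs
  · rw [cast_div_natCast_zmod (not_dvd_prod_digitFactorial a _), div_eq_mul_inv]
    push_cast [digitFactorial]
    rfl
  · simp

/-- Distinct `u` give distinct monomials, so nothing cancels, and the coefficient at a minimizing
`u` is a unit because digits are below `p`. -/
theorem hasseInvariant_ne_zero (hU : (UM p a A M).Nonempty) : hasseInvariant p a A M ≠ 0 := by
  classical
  obtain ⟨u, hu, huw⟩ := Nat.sInf_mem (hU.image (pWeight p a))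
  have hmin : u ∈ UMMin p a A M := ⟨hu, huw⟩
  intro h
  have h1 := congrArg (MvPolynomial.coeff (Finsupp.equivFunOnFinite.symm u)) h
  rw [hasseInvariant, coeff_reduceMod, hasseLift_eq, coeff_sum_monomial,
    Finsupp.coe_equivFunOnFinite_symm, if_pos ((Set.Finite.mem_toFinset _).2 hmin),
    cast_div_natCast_zmod (not_dvd_prod_digitFactorial a _), MvPolynomial.coeff_zero,
    div_eq_zero_iff, ZMod.natCast_eq_zero_iff] at h1
  refine h1.elim (fun h2 => ?_) (not_dvd_prod_digitFactorial a _)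
  push_cast at h2
  exact pow_ne_zero n (neg_ne_zero.2 one_ne_zero) h2

theorem degreeOf_lt_of_coeff {R : Type*} [CommSemiring R] {P : MvPolynomial (Fin N) R} {q : ℕ}
    (hq : 0 < q) {j : Fin N} (h : ∀ m, P.coeff m ≠ 0 → m j < q) : P.degreeOf j < q := by
  rw [MvPolynomial.degreeOf_lt_iff hq]
  exact fun m hm => h m (MvPolynomial.mem_support_iff.1 hm)

theorem lt_of_coeff_ne_zero {R : Type*} [CommSemiring R] {P : MvPolynomial (Fin N) R} {q : ℕ}
    {j : Fin N} (h : P.degreeOf j < q) {m : Fin N →₀ ℕ} (hm : P.coeff m ≠ 0) : m j < q :=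
  (MvPolynomial.degreeOf_lt_iff (Nat.zero_lt_of_lt h)).1 h m (MvPolynomial.mem_support_iff.2 hm)

theorem degreeOf_hasseLift_le (j : Fin N) : (hasseLift p a A M).degreeOf j ≤ p ^ a - 1 := by
  classical
  have hq : 0 < p ^ a := pow_pos (Fact.out : p.Prime).pos a
  refine Nat.le_sub_one_of_lt (degreeOf_lt_of_coeff hq fun m hm => ?_)
  rw [hasseLift_eq, coeff_sum_monomial] at hm
  have hm' := (ite_ne_right_iff.1 hm).1
  exact lt_of_mem_UM (Fact.out : p.Prime).pos ((Set.Finite.mem_toFinset _).1 hm').1 j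

theorem degreeOf_reduceMod_lt {P : MvPolynomial (Fin N) ℚ} {q : ℕ} {j : Fin N}
    (h : P.degreeOf j < q) : (reduceMod p P).degreeOf j < q := by
  refine degreeOf_lt_of_coeff (Nat.zero_lt_of_lt h) fun m hm => lt_of_coeff_ne_zero h fun h0 => hm ?_
  rw [coeff_reduceMod, h0, Rat.cast_zero]

variable {K : Type*} [Field K] [Fintype K] [Algebra (ZMod p) K]

theorem eq_of_forall_aeval_eq {H H' : MvPolynomial (Fin N) (ZMod p)}
    (hH : ∀ j, H.degreeOf j < Fintype.card K) (hH' : ∀ j, H'.degreeOf j < Fintype.card K)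
    (h : ∀ l : Fin N → K, MvPolynomial.aeval l H = MvPolynomial.aeval l H') : H = H' := by
  apply MvPolynomial.map_injective (algebraMap (ZMod p) K) (algebraMap (ZMod p) K).injective
  rw [← sub_eq_zero, ← map_sub]
  refine MvPolynomial.eq_zero_of_eval_zero_at_prod_finset _ (fun _ => Finset.univ) (fun j => ?_)
    fun l _ => ?_
  · rw [Finset.card_univ]
    refine degreeOf_lt_of_coeff Fintype.card_pos fun m hm => ?_
    rw [MvPolynomial.coeff_map, MvPolynomial.coeff_sub] at hm
    by_contra hlt
    apply hm
    rw [not_imp_comm.1 (lt_of_coeff_ne_zero (hH j)) hlt,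
      not_imp_comm.1 (lt_of_coeff_ne_zero (hH' j)) hlt, sub_zero, map_zero]
  · rw [MvPolynomial.eval_map, ← MvPolynomial.aeval_def, map_sub, h, sub_self]

variable (ι : K →+* residueField p)

omit [Fintype K] in
theorem exists_integer_ratCast {r : ℚ} (hr : ¬ p ∣ r.den) :
    ∃ y : integers p, (y : PadicAlgCl p) = (r : PadicAlgCl p) ∧
      IsLocalRing.residue (integers p) y = ι (algebraMap (ZMod p) K (r : ZMod p)) := by
  have hden : ‖(r.den : PadicAlgCl p)‖ = 1 := norm_natCast_eq_one hr
  have hden0 : (r.den : PadicAlgCl p) ≠ 0 := by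
    rw [← norm_ne_zero_iff, hden]; exact one_ne_zero
  have hmul : (r : PadicAlgCl p) * r.den = r.num := by
    exact_mod_cast congrArg (fun t : ℚ => (t : PadicAlgCl p)) (Rat.mul_den_eq_num r)
  have hint : ‖(r : PadicAlgCl p)‖ ≤ 1 := by
    have h := congrArg norm hmul
    rw [norm_mul, hden, mul_one] at h
    rw [h]
    exact IsUltrametricDist.norm_intCast_le_one _ _
  refine ⟨⟨r, mem_integers_iff.2 hint⟩, rfl, ?_⟩
  have hzden : (r.den : ZMod p) ≠ 0 := by rwa [Ne, ZMod.natCast_eq_zero_iff]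
  have hz : (r : ZMod p) * r.den = r.num := by
    rw [Rat.cast_def, div_mul_cancel₀ _ hzden]
  have h1 : (⟨r, mem_integers_iff.2 hint⟩ : integers p) * (r.den : integers p) =
      (r.num : integers p) := Subtype.ext (by push_cast; exact hmul)
  have h2 := congrArg (IsLocalRing.residue (integers p)) h1
  have h3 := congrArg (fun t => ι (algebraMap (ZMod p) K t)) hz
  simp only [map_mul, map_natCast, map_intCast] at h2 h3
  have h4 : (r.den : residueField p) ≠ 0 := by
    have := (map_ne_zero (ι.comp (algebraMap (ZMod p) K))).2 hzden
    rwa [map_natCast] at this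
  exact mul_right_cancel₀ h4 (h2.trans h3.symm)

/-- Evaluation at Teichmüller representatives commutes with reduction, since `ω` lifts `ι` and the
coefficients are `p`-integral. -/
theorem exists_integer_aeval {P : MvPolynomial (Fin N) ℚ} (hP : IsPIntegral p P)
    (l : Fin N → K) :
    ∃ y : integers p, (y : PadicAlgCl p) = MvPolynomial.aeval (fun j => teichmuller ι (l j)) P ∧
      IsLocalRing.residue (integers p) y = ι (MvPolynomial.aeval l (reduceMod p P)) := by
  choose c hc hcres using fun m => exists_integer_ratCast (K := K) ι (hP m)
  refine ⟨∑ m ∈ P.support, c m * ∏ j, teichmullerInt ι (l j) ^ m j, ?_, ?_⟩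
  · rw [MvPolynomial.aeval_def, MvPolynomial.eval₂_eq']
    push_cast
    refine Finset.sum_congr rfl fun m _ => ?_
    rw [hc, eq_ratCast]
    rfl
  · rw [reduceMod, map_sum, map_sum, map_sum]
    refine Finset.sum_congr rfl fun m _ => ?_
    rw [MvPolynomial.aeval_monomial, Finsupp.prod_fintype _ _ (by simp)]
    simp only [map_mul, map_prod, map_pow, hcres, residue_teichmullerInt]

end Reduction

/-! ### The leading term of a function on `Kᴺ` -/

section Leading

variable {N : ℕ} {p : ℕ} [Fact p.Prime] {K : Type*} [Field K] [Fintype K] [Algebra (ZMod p) K]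
  {ι : K →+* residueField p} {π : PadicAlgCl p} (hπ : π ^ (p - 1) = -(p : PadicAlgCl p))
  {S : (Fin N → K) → PadicAlgCl p}

include hπ in
-- The value of `P` is a unit exactly when its residue is nonzero, and the error is strictly smaller
-- than `‖π‖ ^ C`; the ultrametric inequality then decides.
theorem norm_eq_or_lt_of_congr {P : MvPolynomial (Fin N) ℚ} (hP : IsPIntegral p P) {C : ℕ}
    {l : Fin N → K}
    (h : CongrModPow p π (C + 1) (S l)
      (MvPolynomial.aeval (fun j => teichmuller ι (l j)) P * π ^ C)) :
    (MvPolynomial.aeval l (reduceMod p P) ≠ 0 → ‖S l‖ = ‖π‖ ^ C) ∧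
      (MvPolynomial.aeval l (reduceMod p P) = 0 → ‖S l‖ < ‖π‖ ^ C) := by
  obtain ⟨y, hy, hyres⟩ := exists_integer_aeval ι hP l
  have hπ0 := norm_pos_iff.2 (uniformizer_ne_zero hπ)
  have hπC : 0 < ‖π‖ ^ C := pow_pos hπ0 C
  have hlt : ‖π‖ ^ (C + 1) < ‖π‖ ^ C := by
    rw [pow_succ]
    exact mul_lt_of_lt_one_right hπC (norm_uniformizer_lt_one hπ)
  rw [congrModPow_iff hπ, ← hy] at h
  have hd := h.trans_lt hlt
  have hnorm : ‖(y : PadicAlgCl p) * π ^ C‖ = ‖(y : PadicAlgCl p)‖ * ‖π‖ ^ C := by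
    rw [norm_mul, norm_pow]
  constructor
  · intro hne
    have hy1 : ‖(y : PadicAlgCl p)‖ = 1 := by
      refine le_antisymm (mem_integers_iff.1 y.2) (not_lt.1 fun hlt => hne ?_)
      rw [residue_eq_zero_iff.2 hlt] at hyres
      exact (map_eq_zero ι).1 hyres.symm
    rw [hy1, one_mul] at hnorm
    rw [← hnorm] at hd ⊢
    rw [sub_eq_add_neg] at hd
    have h2 := IsUltrametricDist.norm_eq_of_add_norm_lt_max
      (hd.trans_le (le_max_right ‖S l‖ _ |>.trans' (norm_neg _).ge))
    rwa [norm_neg] at h2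
  · intro h0
    rw [h0, map_zero, residue_eq_zero_iff] at hyres
    have h1 : ‖(y : PadicAlgCl p) * π ^ C‖ < ‖π‖ ^ C := by
      rw [hnorm]
      exact mul_lt_of_lt_one_left hπC hyres
    have h2 := IsUltrametricDist.norm_add_le_max (S l - (y : PadicAlgCl p) * π ^ C)
      ((y : PadicAlgCl p) * π ^ C)
    rw [sub_add_cancel] at h2
    exact h2.trans_lt (max_lt hd h1)

include hπ in
-- At a point where `H` does not vanish the norm of `S` is exactly `‖π‖ ^ C`, while the other pair
-- bounds it by `‖π‖ ^ C'` everywhere.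
theorem IsHasseInvariant.exponent_le {C C' : ℕ} {H H' : MvPolynomial (Fin N) (ZMod p)}
    (h : IsHasseInvariant ι π S C H) (h' : IsHasseInvariant ι π S C' H') : C' ≤ C := by
  obtain ⟨P, hP, hdeg, rfl, hne, hS⟩ := h
  obtain ⟨P', hP', hdeg', rfl, hne', hS'⟩ := h'
  have hq : 0 < Fintype.card K := Fintype.card_pos
  obtain ⟨l, hl⟩ : ∃ l : Fin N → K, MvPolynomial.aeval l (reduceMod p P) ≠ 0 := by
    by_contra! hall
    refine hne (eq_of_forall_aeval_eq (K := K) (fun j => ?_) (fun j => ?_) fun l => ?_)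
    · exact degreeOf_reduceMod_lt (by have := hdeg j; omega)
    · rw [MvPolynomial.degreeOf_zero]; exact hq
    · rw [hall, map_zero]
  have h1 := (norm_eq_or_lt_of_congr hπ hP (hS l)).1 hl
  have h2 : ‖S l‖ ≤ ‖π‖ ^ C' := by
    have h3 := norm_eq_or_lt_of_congr hπ hP' (hS' l)
    by_cases h4 : MvPolynomial.aeval l (reduceMod p P') = 0
    · exact (h3.2 h4).le
    · exact (h3.1 h4).le
  rw [h1] at h2
  exact (pow_le_pow_iff_right_of_lt_one₀ (norm_pos_iff.2 (uniformizer_ne_zero hπ))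
    (norm_uniformizer_lt_one hπ)).1 h2

include hπ in
-- Once the exponents agree, dividing by `π ^ C` shows that both lifts agree modulo `π` at every
-- point, so the reductions have equal values on `Kᴺ`.
theorem IsHasseInvariant.unique {C C' : ℕ} {H H' : MvPolynomial (Fin N) (ZMod p)}
    (h : IsHasseInvariant ι π S C H) (h' : IsHasseInvariant ι π S C' H') : C = C' ∧ H = H' := by
  have hC : C = C' := le_antisymm (h'.exponent_le hπ h) (h.exponent_le hπ h')
  refine ⟨hC, ?_⟩
  subst hC
  obtain ⟨P, hP, hdeg, rfl, hne, hS⟩ := h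
  obtain ⟨P', hP', hdeg', rfl, hne', hS'⟩ := h'
  have hq : 0 < Fintype.card K := Fintype.card_pos
  refine eq_of_forall_aeval_eq (K := K)
    (fun j => degreeOf_reduceMod_lt (by have := hdeg j; omega))
    (fun j => degreeOf_reduceMod_lt (by have := hdeg' j; omega)) fun l => ?_
  obtain ⟨y, hy, hyres⟩ := exists_integer_aeval ι hP l
  obtain ⟨y', hy', hyres'⟩ := exists_integer_aeval ι hP' l
  have h1 := hS l
  have h2 := hS' l
  rw [congrModPow_iff hπ, ← hy] at h1
  rw [congrModPow_iff hπ, ← hy'] at h2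
  rw [norm_sub_rev] at h1
  have h3 := norm_sub_trans h1 h2
  have hπ0 := norm_pos_iff.2 (uniformizer_ne_zero hπ)
  rw [← sub_mul, norm_mul, norm_pow, pow_succ', mul_le_mul_iff_left₀ (pow_pos hπ0 C)] at h3
  have h4 : IsLocalRing.residue (integers p) (y - y') = 0 :=
    residue_eq_zero_iff.2 (h3.trans_lt (norm_uniformizer_lt_one hπ))
  rw [map_sub, hyres, hyres', sub_eq_zero] at h4
  exact ι.injective h4

include hπ in
theorem logb_norm_uniformizer_pow (C : ℕ) :
    -Real.logb p (‖π‖ ^ C) = (C : ℝ) / ((p : ℝ) - 1) := by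
  have hp1 : (1 : ℝ) < p := by exact_mod_cast (Fact.out : p.Prime).one_lt
  have h := congrArg (Real.logb p) (norm_uniformizer_pow hπ)
  rw [Real.logb_pow, Real.logb_inv, Real.logb_self_eq_one hp1,
    Nat.cast_sub (Fact.out : p.Prime).one_lt.le, Nat.cast_one] at h
  have hp0 : (p : ℝ) - 1 ≠ 0 := by linarith
  rw [Real.logb_pow]
  field_simp
  linear_combination (-C : ℝ) * h

include hπ in
theorem ordP_eq_of_norm_eq {x : PadicAlgCl p} {C : ℕ} (h : ‖x‖ = ‖π‖ ^ C) :
    ordP p x = (((C : ℝ) / ((p : ℝ) - 1) : ℝ) : WithTop ℝ) := by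
  have hx : x ≠ 0 := by
    rw [← norm_ne_zero_iff, h]
    exact pow_ne_zero _ (norm_ne_zero_iff.2 (uniformizer_ne_zero hπ))
  rw [ordP, if_neg hx, h, logb_norm_uniformizer_pow hπ]

include hπ in
theorem lt_ordP_of_norm_lt {x : PadicAlgCl p} {C : ℕ} (h : ‖x‖ < ‖π‖ ^ C) :
    (((C : ℝ) / ((p : ℝ) - 1) : ℝ) : WithTop ℝ) < ordP p x := by
  rw [ordP]
  split_ifs with hx
  · exact WithTop.coe_lt_top _
  · rw [WithTop.coe_lt_coe, ← logb_norm_uniformizer_pow hπ, neg_lt_neg_iff]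
    exact Real.logb_lt_logb (by exact_mod_cast (Fact.out : p.Prime).one_lt)
      (norm_pos_iff.2 hx) h

end Leading

end ToricSum

end

/-! ### Assembly of the three claims -/

theorem theorem6p6 {n N : ℕ} (p a : ℕ) [Fact p.Prime]
    (K : Type*) [Field K] [Fintype K] [Algebra (ZMod p) K] (hK : Fintype.card K = p ^ a)
    (ι : K →+* ToricSum.residueField p)
    (π : PadicAlgCl p) (hπ : π ^ (p - 1) = -(p : PadicAlgCl p))
    (ζ : PadicAlgCl p) (hζ : ζ ^ p = 1) (hζπ : ToricSum.CongrModPow p π 2 ζ (1 + π))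
    (A : Fin N → Fin n → ℤ) (e : Fin n → ℤ) (M : Set (Fin n → ℤ))
    (hM : M = ToricSum.twistCoset (p ^ a) e) (hU : (ToricSum.UM p a A M).Nonempty) :
    ToricSum.hasseInvariant p a A M =
        (-1) ^ n * ∑ γ ∈ (ToricSum.gam_finite p a A M).toFinset,
          ∏ k : Fin a, MvPolynomial.expand (p ^ (k : ℕ)) (ToricSum.F p A (γ k)) ∧
    (∀ (C : ℕ) (H : MvPolynomial (Fin N) (ZMod p)),
      ToricSum.IsHasseInvariant ι π
          (fun l => ToricSum.expSum ι (ToricSum.additiveChar K hζ) A e l) C H ↔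
        C = ToricSum.pWeightSet p a A M ∧ H = ToricSum.hasseInvariant p a A M) ∧
    ∀ l : Fin N → K,
      (MvPolynomial.aeval l (ToricSum.hasseInvariant p a A M) ≠ 0 →
        ToricSum.ordP p (ToricSum.expSum ι (ToricSum.additiveChar K hζ) A e l) =
          (((ToricSum.pWeightSet p a A M : ℝ) / ((p : ℝ) - 1) : ℝ) : WithTop ℝ)) ∧
      (MvPolynomial.aeval l (ToricSum.hasseInvariant p a A M) = 0 →
        (((ToricSum.pWeightSet p a A M : ℝ) / ((p : ℝ) - 1) : ℝ) : WithTop ℝ) <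
          ToricSum.ordP p (ToricSum.expSum ι (ToricSum.additiveChar K hζ) A e l)) := by
  have hcongr : ∀ l : Fin N → K, ToricSum.CongrModPow p π (ToricSum.pWeightSet p a A M + 1)
      (ToricSum.expSum ι (ToricSum.additiveChar K hζ) A e l)
      (MvPolynomial.aeval (fun j => ToricSum.teichmuller ι (l j)) (ToricSum.hasseLift p a A M) *
        π ^ ToricSum.pWeightSet p a A M) := fun l =>
    (ToricSum.congrModPow_iff hπ).2 (ToricSum.norm_expSum_sub_le ι hπ hζ hK hζπ A e hM l)
  have hint := ToricSum.isPIntegral_hasseLift (p := p) a A M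
  have hHasse : ToricSum.IsHasseInvariant ι π
      (fun l => ToricSum.expSum ι (ToricSum.additiveChar K hζ) A e l)
      (ToricSum.pWeightSet p a A M) (ToricSum.hasseInvariant p a A M) :=
    ⟨ToricSum.hasseLift p a A M, hint,
      fun j => by rw [hK]; exact ToricSum.degreeOf_hasseLift_le a A M j, rfl,
      ToricSum.hasseInvariant_ne_zero a A M hU, hcongr⟩
  refine ⟨?_, fun C H => ⟨fun h => h.unique hπ hHasse, ?_⟩, fun l => ?_⟩
  · rw [ToricSum.hasseInvariant_eq, ToricSum.sum_UMMin_eq_sum_Gam hM]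
  · rintro ⟨rfl, rfl⟩
    exact hHasse
  · have h := ToricSum.norm_eq_or_lt_of_congr
      (S := fun l => ToricSum.expSum ι (ToricSum.additiveChar K hζ) A e l) hπ hint (hcongr l)
    exact ⟨fun hne => ToricSum.ordP_eq_of_norm_eq hπ (h.1 hne),
      fun h0 => ToricSum.lt_ordP_of_norm_lt hπ (h.2 h0)⟩
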